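/- \textbf{Corollary (the case $d=1$).} Let $J\ge 2$, let $\varphi_1,\dots,\varphi_J:\mathbb R\to\mathbb R$ be similitudes with scaling ratios $0<r_j<1$, and let $F=\bigcup_{j}\varphi_j(F)$ be the associated nonempty compact self-similar set, with convex hull $C=[F]$. Assume that (TSC) $\operatorname{int}C$ is nonempty, $\varphi_j(\operatorname{int}C)\subseteq\operatorname{int}C$ for all $j$, and the sets $\varphi_j(\operatorname{int}C)$ are pairwise disjoint; (NTC) $\operatorname{int} C\not\subseteq\bigcup_j\varphi_j(C)$. Let $D$ be the real solution of $\sum_j r_j^D=1$. Write $V_F(\varepsilon)$ for the length of $\{x:\operatorname{dist}(x,F)\le\varepsilon\}$ and, for open $G$, write $V_G^-(\varepsilon)$ for the length of $\{x\in\overline G:\operatorname{dist}(x,G^c)\le\varepsilon\}$. Then $0<D<1$, $D$ is the Minkowski dimension of $F$ (that is, $1-\log V_F(\varepsilon)/\log\varepsilon\to D$ as $\varepsilon\to0^+$), and the scaling zeta function $\zeta(s)=\sum_{n\ge0}\sum_{w\in\{1,\dots,J\}^n}(r_{w_1}\cdots r_{w_n})^s$ converges for $\operatorname{Re}s>D$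 and extends meromorphically to $\mathbb C$ as $\zeta(s)=1/(1-\sum_j r_j^s)$. Moreover: \begin{enumerate} \item $C\setminus\bigcup_j\varphi_j(C)$ has finitely many connected components $G_1,\dots,G_Q$ (the generators), with $1\le Q\le J-1$. Each $G_q$ is an open interval, of length $l_q>0$, whose inradius $g_q$ (the supremum of the radii of balls contained in $G_q$) equals $l_q/2$, and $V^-_{G_q}(\varepsilon)=2\varepsilon$ for $0\le\varepsilon<g_q$, $V^-_{G_q}(\varepsilon)=l_q$ for $\varepsilon\ge g_q$. Thus $G_q$ is Steiner-like (that is, $V^-_{G_q}(\varepsilon)=\kappa_0(G_q)\,\varepsilon$ for $0<\varepsilon<g_q$ and $V^-_{G_q}(\varepsilon)=-\kappa_1(G_q)=\operatorname{length}(G_q)$ for $\varepsilon\ge g_q$) with $\kappa_0(G_q)=2$ and $\kappa_1(G_q)=-l_q$. \item The geometric zeta functions $\zeta^q_{\mathcal T}(s,\varepsilon)=\zeta(s)\,\varepsilon^{1-s}\sum_{m=0}^{1}\frac{g_q^{s-m}}{s-m}\kappa_m(G_q)$ satisfy, for $\varepsilon>0$ and $s\neq 0,1$, \[\zeta^q_{\mathcal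 T}(s,\varepsilon)=\zeta(s)\,\varepsilon^{1-s}\Bigl(2\frac{g_q^s}{s}-l_q\frac{g_q^{s-1}}{s-1}\Bigr)=\zeta(s)\,\varepsilon^{1-s}\,\frac{2^{1-s}l_q^s}{s(1-s)}.\] \item For every $\varepsilon>0$, \[\operatorname{res}\Bigl(\sum_{q=1}^Q\zeta^q_{\mathcal T}(s,\varepsilon)\,\varepsilon^{s-1};D\Bigr)=\operatorname{res}\Bigl(\zeta(s)\frac{2^{1-s}}{s(1-s)}\sum_{q=1}^Q l_q^s;D\Bigr)=\mathcal M:=\frac{2^{1-D}\sum_{q=1}^Q l_q^D}{D(1-D)\sum_{j=1}^J r_j^D\log r_j^{-1}}.\] \item Non-lattice case: if the additive subgroup $\sum_j(\log r_j)\mathbb Z$ of $\mathbb R$ is not discrete, then $F$ is Minkowski measurable (that is, $\lim_{\varepsilon\to0^+}V_F(\varepsilon)\varepsilon^{D-1}$ exists, is finite and is nonzero) and this limit, the Minkowski content of $F$, equals $\mathcal M$. \item Lattice case: if that subgroup is discrete, then $F$ is not Minkowski measurable, and the average Minkowski content exists and equals $\mathcal M$: \[\lim_{T\to\infty}\frac1{\log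 T}\int_{1/T}^1\varepsilon^{-(1-D)}V_F(\varepsilon)\,\frac{d\varepsilon}{\varepsilon}=\mathcal M.\] \end{enumerate} -/

import Mathlib

open Filter Topology MeasureTheory

noncomputable section

/-! ### Iterated function systems -/

/-- `φ` is a system of similitudes with scaling ratios `r j ∈ (0, 1)`. -/
structure IsSimilitudeSystem {E : Type*} [PseudoMetricSpace E] {J : ℕ}
    (φ : Fin J → E → E) (r : Fin J → ℝ) : Prop where
  ratio_pos : ∀ j, 0 < r j
  ratio_lt_one : ∀ j, r j < 1
  dist_map : ∀ j x y, dist (φ j x) (φ j y) = r j * dist x y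

/-- `F` is the self-similar set of `φ`: nonempty, compact, with `F = ⋃ j, φ j (F)`. -/
structure IsSelfSimilarSet {E : Type*} [TopologicalSpace E] {J : ℕ}
    (φ : Fin J → E → E) (F : Set E) : Prop where
  isCompact : IsCompact F
  nonempty : F.Nonempty
  eq_iUnion : F = ⋃ j, φ j '' F

/-- `U` is a feasible open set for the open set condition. -/
structure IsFeasibleOpenSet {E : Type*} [TopologicalSpace E] {J : ℕ}
    (φ : Fin J → E → E) (U : Set E) : Prop where
  isOpen : IsOpen U
  nonempty : U.Nonempty
  image_subset : ∀ j, φ j '' U ⊆ U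
  disjoint_image : ∀ i j, i ≠ j → Disjoint (φ i '' U) (φ j '' U)

/-- Tileset condition: the open set condition holds with the interior of the convex hull of `F`
as a feasible open set. -/
def TilesetCondition {E : Type*} [NormedAddCommGroup E] [NormedSpace ℝ E] {J : ℕ}
    (φ : Fin J → E → E) (F : Set E) : Prop :=
  IsFeasibleOpenSet φ (interior (convexHull ℝ F))

/-- Nontriviality condition: the interior of `C = [F]` is not covered by `⋃ j, φ j (C)`. -/
def NontrivialityCondition {E : Type*} [NormedAddCommGroup E] [NormedSpace ℝ E] {J : ℕ}
    (φ : Fin J → E → E) (F : Set E) : Prop :=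
  ¬ interior (convexHull ℝ F) ⊆ ⋃ j, φ j '' convexHull ℝ F

/-- The initial tile `T₀ = C \ ⋃ j, φ j (C)`, where `C = [F]`. -/
def initialTile {E : Type*} [NormedAddCommGroup E] [NormedSpace ℝ E] {J : ℕ}
    (φ : Fin J → E → E) (F : Set E) : Set E :=
  convexHull ℝ F \ ⋃ j, φ j '' convexHull ℝ F

/-- The generators of the tiling: the connected components of the initial tile. -/
def generators {E : Type*} [NormedAddCommGroup E] [NormedSpace ℝ E] {J : ℕ}
    (φ : Fin J → E → E) (F : Set E) : Set (Set E) :=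
  {G | ∃ x ∈ initialTile φ F, G = connectedComponentIn (initialTile φ F) x}

/-- Lattice type: the additive subgroup of `ℝ` generated by the `log (r j)` is discrete. -/
def IsLatticeType {J : ℕ} (r : Fin J → ℝ) : Prop :=
  DiscreteTopology (AddSubgroup.closure (Set.range fun j => Real.log (r j)))

/-! ### Minkowski dimension and Minkowski content -/

/-- `V_F(ε)`, the volume of the closed `ε`-neighborhood of `F`. -/
def tubeVolume {E : Type*} [PseudoMetricSpace E] [MeasureSpace E] (F : Set E) (ε : ℝ) : ℝ :=
  volume.real (Metric.cthickening ε F)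

/-- `F` has Minkowski dimension `D`: `d - log V_F(ε) / log ε → D` as `ε → 0⁺`. -/
def HasMinkowskiDimension {E : Type*} [NormedAddCommGroup E] [NormedSpace ℝ E] [MeasureSpace E]
    (F : Set E) (D : ℝ) : Prop :=
  Tendsto (fun ε : ℝ => (Module.finrank ℝ E : ℝ) - Real.log (tubeVolume F ε) / Real.log ε)
    (𝓝[>] 0) (𝓝 D)

/-- The `D`-dimensional Minkowski content of `F` exists and equals the real number `M`:
`V_F(ε) ε ^ (D - d) → M` as `ε → 0⁺`. -/
def HasMinkowskiContent {E : Type*} [NormedAddCommGroup E] [NormedSpace ℝ E] [MeasureSpace E]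
    (F : Set E) (D M : ℝ) : Prop :=
  Tendsto (fun ε : ℝ => tubeVolume F ε * ε ^ (D - (Module.finrank ℝ E : ℝ))) (𝓝[>] 0) (𝓝 M)

/-- `F` is Minkowski measurable (in dimension `D`): the content exists in `ℝ` and is not `0`. -/
def IsMinkowskiMeasurable {E : Type*} [NormedAddCommGroup E] [NormedSpace ℝ E] [MeasureSpace E]
    (F : Set E) (D : ℝ) : Prop :=
  ∃ M : ℝ, M ≠ 0 ∧ HasMinkowskiContent F D M

/-- The average Minkowski content of `F` exists and equals `M`:
`(1 / log T) ∫_{1/T}^1 ε ^ (-(d - D)) V_F(ε) dε / ε → M` as `T → ∞`. -/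
def HasAverageMinkowskiContent {E : Type*} [NormedAddCommGroup E] [NormedSpace ℝ E]
    [MeasureSpace E] (F : Set E) (D M : ℝ) : Prop :=
  Tendsto (fun T : ℝ => 1 / Real.log T *
      ∫ ε in (1 / T)..1, ε ^ (-((Module.finrank ℝ E : ℝ) - D)) * tubeVolume F ε / ε)
    atTop (𝓝 M)

/-! ### Steiner-like generators -/

/-- `V_G^-(ε)`, the volume of the inner `ε`-neighborhood of `G`. -/
def innerTubeVolume {E : Type*} [PseudoMetricSpace E] [MeasureSpace E] (G : Set E) (ε : ℝ) : ℝ :=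
  volume.real {x | x ∈ closure G ∧ Metric.infDist x Gᶜ ≤ ε}

/-- The inradius of `G`: the supremum of the radii of the balls contained in `G`. -/
def inradius {E : Type*} [PseudoMetricSpace E] (G : Set E) : ℝ :=
  sSup {ρ : ℝ | 0 < ρ ∧ ∃ x, Metric.ball x ρ ⊆ G}

/-- The bounded open set `G` is (diphase) Steiner-like with coefficients `κ 0, …, κ d`; the
values `κ m` with `m > d` play no role. -/
structure IsSteinerLike {E : Type*} [NormedAddCommGroup E] [NormedSpace ℝ E] [MeasureSpace E]
    (G : Set E) (κ : ℕ → ℝ) : Prop where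
  isOpen : IsOpen G
  isBounded : Bornology.IsBounded G
  tube_of_lt : ∀ ε : ℝ, 0 < ε → ε < inradius G →
    innerTubeVolume G ε = ∑ m ∈ Finset.range (Module.finrank ℝ E),
      κ m * ε ^ (Module.finrank ℝ E - m)
  tube_of_ge : ∀ ε : ℝ, inradius G ≤ ε → innerTubeVolume G ε = volume.real G
  coeff_top : κ (Module.finrank ℝ E) = -volume.real G

/-! ### Zeta functions -/

/-- The closed form `1 / (1 - ∑ j, r j ^ s)` on `ℂ` of the scaling zeta function. -/
def scalingZeta {J : ℕ} (r : Fin J → ℝ) (s : ℂ) : ℂ :=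
  1 / (1 - ∑ j, (r j : ℂ) ^ s)

/-- `Z` is a meromorphic function on `ℂ` that extends the scaling zeta function
`∑ n, ∑ w ∈ W_n, r_w ^ s`, the series converging for `Re s > D`; here `W_n` is the set of words of
length `n` and `r_w` is the product of the ratios along the word `w`. -/
structure IsScalingZetaExtension {J : ℕ} (r : Fin J → ℝ) (D : ℝ) (Z : ℂ → ℂ) : Prop where
  hasSum : ∀ s : ℂ, D < s.re →
    HasSum (fun n : ℕ => ∑ w : Fin n → Fin J, ((∏ i, r (w i) : ℝ) : ℂ) ^ s) (Z s)
  meromorphicAt : ∀ s : ℂ, MeromorphicAt Z s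

/-- The geometric zeta function of a Steiner-like generator `G` with coefficients `κ`:
`ζ(s) ε ^ (d - s) ∑_{m ≤ d} g ^ (s - m) / (s - m) κ_m`, where `g` is the inradius of `G`. -/
def geometricZeta {E : Type*} [NormedAddCommGroup E] [NormedSpace ℝ E] {J : ℕ}
    (r : Fin J → ℝ) (G : Set E) (κ : ℕ → ℝ) (s : ℂ) (ε : ℝ) : ℂ :=
  scalingZeta r s * (ε : ℂ) ^ ((Module.finrank ℝ E : ℂ) - s) *
    ∑ m ∈ Finset.range (Module.finrank ℝ E + 1),
      (inradius G : ℂ) ^ (s - (m : ℂ)) / (s - (m : ℂ)) * (κ m : ℂ)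

/-- The residue at `z` of `f`, which is meromorphic at `z`, is `a`. -/
def HasResidueAt (f : ℂ → ℂ) (z a : ℂ) : Prop :=
  MeromorphicAt f z ∧
    ∀ᶠ ρ : ℝ in 𝓝[>] 0, (2 * (Real.pi : ℂ) * Complex.I)⁻¹ * (∮ w in C(z, ρ), f w) = a

/-- The number
`2 ^ (1 - D) ∑ q, l q ^ D / (D (1 - D) ∑ j, r j ^ D log (r j)⁻¹)`. -/
def gapContent {J Q : ℕ} (r : Fin J → ℝ) (l : Fin Q → ℝ) (D : ℝ) : ℝ :=
  2 ^ (1 - D) * (∑ q, l q ^ D) / (D * (1 - D) * ∑ j, r j ^ D * Real.log (r j)⁻¹)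

end

noncomputable section

/-! ### Semigroups generating a dense subgroup of the line -/

/-! Let `C = [a, b]`. The tileset condition makes the intervals `φ j '' C` non-overlapping, with
endpoints in `F`; the nontriviality condition leaves at least one gap. Let v(ε) be the length of the
ε-neighborhood of `F` inside `[a, b]`. A gap of length l contributes min(2ε, l) to it; in `φ j '' C`
only the points of `φ j '' F` matter, so scaling gives r_j v(ε/r_j). Hence v(ε) = Σ r_j v(ε/r_j) + Σ
min(2ε, l_q), while V_F(ε) = v(ε) + 2ε (`exists_generators_and_tube`).

With ε = e^{-t}, the function u(t) = e^{(1-D)t} v(e^{-t}) solves a renewal equation whose weights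
p_j = r_j^D have total mass one, whose steps are τ_j = log r_j⁻¹ and whose inhomogeneity z is
integrable; ∫z divided by the mean step is exactly 𝓜. Two-sided bounds on u give the dimension, and
the Minkowski content is the limit of u at ∞.

Integrating the equation over (-∞, t] gives Σ p_j ∫_{t-τ_j}^t u = ∫_{-∞}^t z (`sum_window`). A
second integration yields the averaged content in all cases (`tendsto_average`). If the steps
generate a dense group, then at times where u is near its limsup, averaging forces it near the
limsup at all earlier times shifted by the semigroup of steps, hence nearly so on a long window; the
identity then bounds the limsup by 𝓜. The same argument for -u bounds the liminf (`tendsto_atTop`).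
In the lattice case with period d, a limit of u would make Σ_k z(t + kd) independent of t, so a sum
of rescaled copies of the concave function g(ε) = Σ min(2ε, l_q) would be a multiple of ε^{1-D}; but
g has a corner at l_q/2, and concave terms cannot cancel it (`not_forall_tendsto_sum_logGaps`).

On the analytic side, the sum over words is a geometric series and D is a simple zero of 1 - Σ
r_j^s, with derivative Σ r_j^D log r_j⁻¹, so the residue is 𝓜 as well. -/

theorem AddSubgroup.exists_sub_of_mem_closure {G : Type*} [AddCommGroup G] {S : Set G} {g : G}
    (hg : g ∈ AddSubgroup.closure S) :
    ∃ a ∈ AddSubmonoid.closure S, ∃ b ∈ AddSubmonoid.closure S, g = b - a := by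
  induction hg using AddSubgroup.closure_induction with
  | mem x hx => exact ⟨0, zero_mem _, x, AddSubmonoid.subset_closure hx, by simp⟩
  | zero => exact ⟨0, zero_mem _, 0, zero_mem _, by simp⟩
  | add x y _ _ hx hy =>
    obtain ⟨a, ha, b, hb, rfl⟩ := hx
    obtain ⟨c, hc, d, hd, rfl⟩ := hy
    exact ⟨a + c, add_mem ha hc, b + d, add_mem hb hd, by abel⟩
  | neg x _ hx =>
    obtain ⟨a, ha, b, hb, rfl⟩ := hx
    exact ⟨b, hb, a, ha, by abel⟩

theorem nonneg_of_mem_addSubmonoid_closure {S : Set ℝ} (hS : ∀ x ∈ S, 0 < x) {s : ℝ}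
    (hs : s ∈ AddSubmonoid.closure S) : 0 ≤ s := by
  induction hs using AddSubmonoid.closure_induction with
  | mem x hx => exact (hS x hx).le
  | zero => exact le_rfl
  | add x y _ _ hx hy => exact add_nonneg hx hy

/-- A semigroup of positive reals that generates a dense subgroup is asymptotically dense. -/
theorem exists_forall_ge_exists_mem_addSubmonoid_closure {S : Set ℝ} (hne : S.Nonempty)
    (hS : ∀ x ∈ S, 0 < x) (hd : Dense (AddSubgroup.closure S : Set ℝ)) {δ : ℝ} (hδ : 0 < δ) :
    ∃ A : ℝ, ∀ x ≥ A, ∃ s ∈ AddSubmonoid.closure S, s ≤ x ∧ x ≤ s + δ := by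
  obtain ⟨t, ht⟩ := hne
  obtain ⟨g, hg, hg0, hgδ⟩ := hd.exists_between hδ
  obtain ⟨a, ha, b, hb, rfl⟩ := AddSubgroup.exists_sub_of_mem_closure hg
  have ht0 := hS t ht
  have ha0 := nonneg_of_mem_addSubmonoid_closure hS ha
  have ha' : a + t ∈ AddSubmonoid.closure S := add_mem ha (AddSubmonoid.subset_closure ht)
  have hb' : b + t ∈ AddSubmonoid.closure S := add_mem hb (AddSubmonoid.subset_closure ht)
  -- Adding the generator `t` to both elements keeps their difference `d` and makes the smaller one
  -- positive, so that it can be divided by.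
  set a' := a + t with ha'_def
  have ha'0 : 0 < a' := by positivity
  set d := b - a with hd_def
  have hbd : b + t = a' + d := by simp only [ha'_def, hd_def]; ring
  rw [hbd] at hb'
  obtain ⟨n₀, hn₀⟩ := exists_nat_ge (a' / d)
  -- The elements `n * a' + k * d` with `k ≤ n` lie in the semigroup and advance from `n * a'` by
  -- steps `d < δ`. For `n ≥ n₀` one has `n * d ≥ a'`, so they reach `(n + 1) * a'` and leave no
  -- hole.
  refine ⟨n₀ * a', fun x hx => ?_⟩
  have hx0 : 0 ≤ x := le_trans (by positivity) hx
  set n := ⌊x / a'⌋₊ with hn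
  have hn1 : (n : ℝ) * a' ≤ x := (le_div_iff₀ ha'0).1 (Nat.floor_le (by positivity))
  have hn2 : x < (n + 1) * a' := (div_lt_iff₀ ha'0).1 (Nat.lt_floor_add_one _)
  have hnn : n₀ ≤ n := Nat.le_floor ((le_div_iff₀ ha'0).2 hx)
  have hnd : a' ≤ n * d := by
    have h1 : a' ≤ n₀ * d := (div_le_iff₀ hg0).1 hn₀
    have h2 : (n₀ : ℝ) ≤ n := by exact_mod_cast hnn
    nlinarith
  set k := ⌊(x - n * a') / d⌋₊ with hk
  have hk1 : (k : ℝ) * d ≤ x - n * a' :=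
    (le_div_iff₀ hg0).1 (Nat.floor_le (div_nonneg (by linarith) hg0.le))
  have hk2 : x - n * a' < (k + 1) * d := (div_lt_iff₀ hg0).1 (Nat.lt_floor_add_one _)
  have hkn : k ≤ n := by
    have : (k : ℝ) ≤ n := by
      by_contra! h
      nlinarith
    exact_mod_cast this
  obtain ⟨m, hm⟩ := Nat.exists_eq_add_of_le hkn
  refine ⟨m • a' + k • (a' + d), add_mem (nsmul_mem ha' m) (nsmul_mem hb' k), ?_, ?_⟩
  all_goals
    have hm' : (n : ℝ) = k + m := by exact_mod_cast hm
    simp only [nsmul_eq_mul]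
    rw [hm'] at hk1 hk2
    nlinarith

/-- Finiteness of `E` matters because only finitely many eventual statements can be intersected. The
threshold `A` does not depend on the window length. Half of `δ` pays for rounding to a grid, half
for the semigroup. -/
theorem exists_finset_addSubmonoid_closure {S : Set ℝ} (hne : S.Nonempty)
    (hS : ∀ x ∈ S, 0 < x) (hd : Dense (AddSubgroup.closure S : Set ℝ)) {δ : ℝ} (hδ : 0 < δ) :
    ∃ A : ℝ, ∀ T : ℝ, ∃ E : Finset ℝ, (∀ s ∈ E, s ∈ AddSubmonoid.closure S) ∧
      ∀ x ∈ Set.Icc A (A + T), ∃ s ∈ E, s ≤ x ∧ x ≤ s + δ := by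
  obtain ⟨A, hA⟩ := exists_forall_ge_exists_mem_addSubmonoid_closure hne hS hd (half_pos hδ)
  choose! f hfm hf1 hf2 using hA
  refine ⟨A, fun T => ?_⟩
  set N := ⌊T / (δ / 2)⌋₊ + 1
  refine ⟨(Finset.range N).image fun n : ℕ => f (A + n * (δ / 2)), ?_, ?_⟩
  · intro s hs
    obtain ⟨n, -, rfl⟩ := Finset.mem_image.1 hs
    exact hfm _ (by simp; positivity)
  · rintro x ⟨hx1, hx2⟩
    have hδ2 := half_pos hδ
    set n := ⌊(x - A) / (δ / 2)⌋₊ with hn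
    have hn1 : (n : ℝ) * (δ / 2) ≤ x - A :=
      (le_div_iff₀ hδ2).1 (Nat.floor_le (div_nonneg (by linarith) hδ2.le))
    have hn2 : x - A < (n + 1) * (δ / 2) := (div_lt_iff₀ hδ2).1 (Nat.lt_floor_add_one _)
    have hAn : A + n * (δ / 2) ≥ A := by simp; positivity
    refine ⟨f (A + n * (δ / 2)), Finset.mem_image_of_mem _ (Finset.mem_range.2 ?_), ?_, ?_⟩
    · exact Nat.lt_succ_of_le (Nat.floor_le_floor (by gcongr; linarith))
    · linarith [hf1 _ hAn]
    · linarith [hf2 _ hAn]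

/-! ### The renewal equation -/

/-- A weighted mean of values that are asymptotically at most `S` can only tend to `S` if every
value does. The filter is quantified after `s` so that the induction can pass to shifted filters. -/
theorem tendsto_comp_sub_of_renewal {ι : Type*} [Fintype ι] {p τ : ι → ℝ} {u z : ℝ → ℝ}
    (hp : ∀ j, 0 < p j) (hp1 : ∑ j, p j = 1)
    (heq : ∀ t, u t = ∑ j, p j * u (t - τ j) + z t) (hz : Tendsto z atTop (𝓝 0)) {S : ℝ}
    (hup : ∀ η > 0, ∀ᶠ t in atTop, u t ≤ S + η) {s : ℝ}
    (hs : s ∈ AddSubmonoid.closure (Set.range τ)) :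
    ∀ l : Filter ℝ, l ≤ atTop → Tendsto u l (𝓝 S) → Tendsto (fun t => u (t - s)) l (𝓝 S) := by
  classical
  induction hs using AddSubmonoid.closure_induction with
  | mem x hx =>
    obtain ⟨j, rfl⟩ := hx
    intro l hl hu
    have hsub : ∀ k, Tendsto (fun t : ℝ => t - τ k) l atTop := fun k =>
      (tendsto_atTop_add_const_right atTop (-τ k) tendsto_id).mono_left hl
    rw [Metric.tendsto_nhds]
    intro ε hε
    -- Errors of size `η` come from `u t`, from `z t` and from the other terms of the mean; together
    -- they stay below `p j * ε`.
    set η := min (ε / 2) (p j * ε / 4) with hη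
    have hpj := hp j
    have hη0 : 0 < η := by positivity
    have h1 : ∀ᶠ t in l, ∀ k, u (t - τ k) ≤ S + η :=
      eventually_all.2 fun k => (hsub k).eventually (hup η hη0)
    have h2 : ∀ᶠ t in l, |z t| < η := by
      simpa using (hz.mono_left hl).eventually (Metric.ball_mem_nhds 0 hη0)
    have h3 : ∀ᶠ t in l, |u t - S| < η := hu.eventually (Metric.ball_mem_nhds S hη0)
    filter_upwards [h1, h2, h3] with t ht1 ht2 ht3
    have key : ∑ k ∈ Finset.univ.erase j, p k * u (t - τ k) ≤ (1 - p j) * (S + η) := by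
      have : (1 - p j) = ∑ k ∈ Finset.univ.erase j, p k := by
        rw [← hp1, ← Finset.add_sum_erase _ _ (Finset.mem_univ j)]; ring
      rw [this, Finset.sum_mul]
      exact Finset.sum_le_sum fun k _ => mul_le_mul_of_nonneg_left (ht1 k) (hp k).le
    have hh := heq t
    rw [← Finset.add_sum_erase _ _ (Finset.mem_univ j)] at hh
    rw [abs_lt] at ht2 ht3
    have hj := ht1 j
    have e1 : η ≤ ε / 2 := min_le_left _ _
    have e2 : η ≤ p j * ε / 4 := min_le_right _ _
    rw [Real.dist_eq, abs_lt]
    constructor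
    · have hmul : p j * (-ε) < p j * (u (t - τ j) - S) := by nlinarith
      exact lt_of_mul_lt_mul_left hmul hpj.le
    · linarith
  | zero => intro l _ hu; simpa using hu
  | add x y _ _ hx hy =>
    intro l hl hu
    have h1 := hx l hl hu
    have h2 := hy (map (fun t => t - x) l)
      ((tendsto_atTop_add_const_right atTop (-x) tendsto_id).mono_left hl) h1
    rw [tendsto_map'_iff] at h2
    refine h2.congr fun t => ?_
    simp [sub_sub]

/-- A locally integrable solution of the renewal equation `u t = ∑ j, p j * u (t - τ j) + z t`
with data integrable at `-∞`. -/
structure IsRenewalSolution {ι : Type*} [Fintype ι] (p τ : ι → ℝ) (u z : ℝ → ℝ) : Prop where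
  weight_pos : ∀ j, 0 < p j
  weight_sum : ∑ j, p j = 1
  step_pos : ∀ j, 0 < τ j
  eq : ∀ t, u t = ∑ j, p j * u (t - τ j) + z t
  integrableOn : ∀ t, IntegrableOn u (Set.Iic t)
  integrable : Integrable z
  tendsto_zero : Tendsto z atTop (𝓝 0)

theorem integrableOn_comp_sub_Iic {u : ℝ → ℝ} {t a : ℝ} (h : IntegrableOn u (Set.Iic (t - a))) :
    IntegrableOn (fun s => u (s - a)) (Set.Iic t) := by
  have := (measurePreserving_sub_right volume a).integrableOn_comp_preimage
    (measurableEmbedding_subRight a) (f := u) (s := Set.Iic (t - a))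
  simp only [Set.preimage_sub_const_Iic, sub_add_cancel] at this
  exact this.2 h

theorem setIntegral_comp_sub_Iic (u : ℝ → ℝ) (t a : ℝ) :
    ∫ s in Set.Iic t, u (s - a) = ∫ s in Set.Iic (t - a), u s := by
  have := (measurePreserving_sub_right volume a).setIntegral_preimage_emb
    (measurableEmbedding_subRight a) u (Set.Iic (t - a))
  simpa only [Set.preimage_sub_const_Iic, sub_add_cancel] using this

namespace IsRenewalSolution

variable {ι : Type*} [Fintype ι] {p τ : ι → ℝ} {u z : ℝ → ℝ}

theorem intervalIntegrable (h : IsRenewalSolution p τ u z) (a b : ℝ) :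
    IntervalIntegrable u volume a b := by
  rw [intervalIntegrable_iff]
  exact (h.integrableOn (max a b)).mono_set fun x hx => hx.2

theorem setIntegral_Iic (h : IsRenewalSolution p τ u z) (t : ℝ) :
    ∫ s in Set.Iic t, u s =
      ∑ j, p j * (∫ s in Set.Iic (t - τ j), u s) + ∫ s in Set.Iic t, z s := by
  have h1 : ∀ j ∈ Finset.univ, Integrable (fun s => p j * u (s - τ j))
      (volume.restrict (Set.Iic t)) := fun j _ =>
    (integrableOn_comp_sub_Iic (h.integrableOn _)).const_mul _
  rw [setIntegral_congr_fun measurableSet_Iic (fun s _ => h.eq s),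
    integral_add (integrable_finsetSum _ h1) h.integrable.integrableOn, integral_finsetSum _ h1]
  simp_rw [integral_const_mul, setIntegral_comp_sub_Iic]

/-- The weights sum to one, so the integrals over half-lines cancel except on the windows skipped by
the steps. This conservation law is how the total mass of `z` enters both limit theorems. -/
theorem sum_window (h : IsRenewalSolution p τ u z) (t : ℝ) :
    ∑ j, p j * (∫ s in (t - τ j)..t, u s) = ∫ s in Set.Iic t, z s := by
  have h1 : ∀ j, ∫ s in (t - τ j)..t, u s =
      (∫ s in Set.Iic t, u s) - ∫ s in Set.Iic (t - τ j), u s := fun j =>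
    (intervalIntegral.integral_Iic_sub_Iic (h.integrableOn _) (h.integrableOn _)).symm
  simp_rw [h1, mul_sub]
  rw [Finset.sum_sub_distrib, ← Finset.sum_mul, h.weight_sum, one_mul]
  linarith [h.setIntegral_Iic t]

theorem tendsto_setIntegral_Iic (h : IsRenewalSolution p τ u z) :
    Tendsto (fun t => ∫ s in Set.Iic t, z s) atTop (𝓝 (∫ s, z s)) :=
  (aecover_Iic tendsto_id).integral_tendsto_of_countably_generated h.integrable

theorem neg (h : IsRenewalSolution p τ u z) :
    IsRenewalSolution p τ (fun t => -u t) (fun t => -z t) where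
  weight_pos := h.weight_pos
  weight_sum := h.weight_sum
  step_pos := h.step_pos
  eq t := by
    rw [h.eq t]
    simp [Finset.sum_neg_distrib, add_comm]
  integrableOn t := (h.integrableOn t).neg
  integrable := h.integrable.neg
  tendsto_zero := by simpa using h.tendsto_zero.neg

/-- If a solution stays above `c` on arbitrarily late windows, then `c` times the mean step is at
most the total mass of the inhomogeneity. -/
theorem mean_mul_le (h : IsRenewalSolution p τ u z) {l : Filter ℝ} [l.NeBot] (hl : l ≤ atTop)
    {A T c : ℝ} (hT : ∀ j, τ j ≤ T)
    (hc : ∀ᶠ t in l, ∀ x ∈ Set.Icc A (A + T), c ≤ u (t - x)) :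
    c * ∑ j, p j * τ j ≤ ∫ s, z s := by
  have hlim : Tendsto (fun t => ∫ s in Set.Iic (t - A), z s) l (𝓝 (∫ s, z s)) :=
    h.tendsto_setIntegral_Iic.comp
      ((tendsto_atTop_add_const_right atTop (-A) tendsto_id).mono_left hl)
  refine ge_of_tendsto hlim ?_
  filter_upwards [hc] with t ht
  rw [← h.sum_window, Finset.mul_sum]
  refine Finset.sum_le_sum fun j _ => ?_
  have hτ := h.step_pos j
  have : ∫ _s in (t - A - τ j)..(t - A), c ≤ ∫ s in (t - A - τ j)..(t - A), u s := by
    refine intervalIntegral.integral_mono_on (by linarith) (by simp)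
      (h.intervalIntegrable _ _) fun s hs => ?_
    have := ht (t - s) ⟨by linarith [hs.2], by linarith [hs.1, hT j]⟩
    simpa using this
  rw [intervalIntegral.integral_const, smul_eq_mul] at this
  calc c * (p j * τ j) = p j * ((t - A - (t - A - τ j)) * c) := by ring
    _ ≤ _ := mul_le_mul_of_nonneg_left this (h.weight_pos j).le

/-- The ultrafilter plays the role of a sequence realizing the limsup, with no need to pass to
subsequences. -/
theorem exists_ultrafilter_limsup {f : ℝ → ℝ} {B : ℝ} (hB : ∀ t, |f t| ≤ B) :
    ∃ S : ℝ, (∀ η > 0, ∀ᶠ t in atTop, f t ≤ S + η) ∧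
      ∃ l : Ultrafilter ℝ, (l : Filter ℝ) ≤ atTop ∧ Tendsto f l (𝓝 S) := by
  have hb1 : IsBoundedUnder (· ≤ ·) atTop f := isBoundedUnder_of ⟨B, fun t => (abs_le.1 (hB t)).2⟩
  have hb2 : IsBoundedUnder (· ≥ ·) atTop f := isBoundedUnder_of ⟨-B, fun t => (abs_le.1 (hB t)).1⟩
  refine ⟨limsup f atTop, fun η hη => ?_, ?_⟩
  · exact (eventually_lt_of_limsup_lt (lt_add_of_pos_right _ hη) hb1).mono fun t ht => ht.le
  · rw [← mapClusterPt_iff_ultrafilter, mapClusterPt_iff_frequently]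
    intro s hs
    obtain ⟨ε, hε, hεs⟩ := Metric.mem_nhds_iff.1 hs
    have h1 := eventually_lt_of_limsup_lt (lt_add_of_pos_right (limsup f atTop) hε) hb1
    have h2 : ∃ᶠ t in atTop, limsup f atTop - ε < f t :=
      frequently_lt_of_lt_limsup hb2.isCoboundedUnder_le (sub_lt_self _ hε)
    refine (h2.and_eventually h1).mono fun t ht => hεs ?_
    rw [Metric.mem_ball, Real.dist_eq, abs_lt]
    constructor <;> linarith [ht.1, ht.2]

/-- Renewal theorem, non-arithmetic case. -/
theorem tendsto_atTop [Nonempty ι] (h : IsRenewalSolution p τ u z)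
    (hdense : Dense (AddSubgroup.closure (Set.range τ) : Set ℝ)) {B : ℝ} (h0 : ∀ t, 0 ≤ u t) (hB : ∀ t, |u t| ≤ B)
    {κ : ℝ} (hκ : 0 ≤ κ)
    (hmono : ∀ t δ, 0 ≤ δ → u (t + δ) ≤ Real.exp (κ * δ) * u t) :
    Tendsto u atTop (𝓝 ((∫ s, z s) / ∑ j, p j * τ j)) := by
  have hm : 0 < ∑ j, p j * τ j :=
    Finset.sum_pos (fun j _ => mul_pos (h.weight_pos j) (h.step_pos j)) Finset.univ_nonempty
  have hne : (Set.range τ).Nonempty := Set.range_nonempty _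
  have hpos : ∀ x ∈ Set.range τ, 0 < x := by rintro _ ⟨j, rfl⟩; exact h.step_pos j
  set T := ∑ j, τ j with hTdef
  have hT : ∀ j, τ j ≤ T := fun j =>
    Finset.single_le_sum (fun k _ => (h.step_pos k).le) (Finset.mem_univ j)
  have hexp : Tendsto (fun δ : ℝ => Real.exp (κ * δ)) (𝓝[>] 0) (𝓝 1) := by
    have : Tendsto (fun δ : ℝ => Real.exp (κ * δ)) (𝓝 0) (𝓝 (Real.exp (κ * 0))) :=
      (by fun_prop : Continuous fun δ : ℝ => Real.exp (κ * δ)).tendsto 0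
    rw [mul_zero, Real.exp_zero] at this
    exact this.mono_left nhdsWithin_le_nhds
  have hid : Tendsto (fun δ : ℝ => δ) (𝓝[>] 0) (𝓝 0) := tendsto_id.mono_left nhdsWithin_le_nhds
  obtain ⟨S₁, hS₁, l₁, hl₁, hu₁⟩ := exists_ultrafilter_limsup hB
  obtain ⟨S₂, hS₂, l₂, hl₂, hu₂⟩ := exists_ultrafilter_limsup (f := fun t => -u t) (B := B)
    (by simpa using hB)
  have upper : S₁ * ∑ j, p j * τ j ≤ ∫ s, z s := by
    have key : ∀ δ > 0, (Real.exp (κ * δ))⁻¹ * (S₁ - δ) * ∑ j, p j * τ j ≤ ∫ s, z s := by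
      intro δ hδ
      obtain ⟨A, hA⟩ := exists_finset_addSubmonoid_closure hne hpos hdense hδ
      obtain ⟨E, hE, hEx⟩ := hA T
      refine h.mean_mul_le hl₁ (A := A) hT ?_
      have : ∀ᶠ t in (l₁ : Filter ℝ), ∀ s ∈ E, S₁ - δ < u (t - s) := by
        rw [Finset.eventually_all]
        exact fun s hs => (tendsto_comp_sub_of_renewal h.weight_pos h.weight_sum h.eq
          h.tendsto_zero hS₁ (hE s hs) _ hl₁ hu₁).eventually_const_lt (by linarith)
      filter_upwards [this] with t ht x hx
      obtain ⟨s, hs, hsx, hxs⟩ := hEx x hx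
      -- Here `s ≤ x`, so `t - x` is the earlier time: a lower bound for `u (t - s)` gives one for
      -- `u (t - x)`, up to the factor `exp (κ * δ)`.
      have h1 := hmono (t - x) (x - s) (by linarith)
      rw [sub_add_sub_cancel] at h1
      have h2 := ht s hs
      rw [inv_mul_le_iff₀ (Real.exp_pos _)]
      have h3 : Real.exp (κ * (x - s)) ≤ Real.exp (κ * δ) :=
        Real.exp_le_exp.2 (mul_le_mul_of_nonneg_left (by linarith) hκ)
      nlinarith [mul_le_mul_of_nonneg_right h3 (h0 (t - x))]
    refine le_of_tendsto (x := 𝓝[>] (0 : ℝ)) ?_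
      (eventually_nhdsWithin_of_forall fun δ hδ => key δ hδ)
    have := ((hexp.inv₀ one_ne_zero).mul (hid.const_sub S₁)).mul_const (∑ j, p j * τ j)
    simpa using this
  -- `-S₂` is the liminf of `u`.
  have lower : S₂ * ∑ j, p j * τ j ≤ ∫ s, -z s := by
    have key : ∀ δ > 0, (Real.exp (κ * δ)) * (S₂ - δ) * ∑ j, p j * τ j ≤ ∫ s, -z s := by
      intro δ hδ
      obtain ⟨A, hA⟩ := exists_finset_addSubmonoid_closure hne hpos hdense hδ
      obtain ⟨E, hE, hEx⟩ := hA (T + δ)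
      refine h.neg.mean_mul_le hl₂ (A := A) hT ?_
      have : ∀ᶠ t in (l₂ : Filter ℝ), ∀ s ∈ E, S₂ - δ < -u (t - s) := by
        rw [Finset.eventually_all]
        exact fun s hs => (tendsto_comp_sub_of_renewal h.weight_pos h.weight_sum h.neg.eq
          h.neg.tendsto_zero hS₂ (hE s hs) _ hl₂ hu₂).eventually_const_lt (by linarith)
      filter_upwards [this] with t ht x hx
      -- Upper bounds for `u` propagate forward in time, so `s ≥ x` is needed; approximating `x + δ`
      -- from below ensures it and explains the window length `T + δ`.
      obtain ⟨s, hs, hsx, hxs⟩ := hEx (x + δ) ⟨by linarith [hx.1], by linarith [hx.2]⟩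
      have h1 := hmono (t - s) (s - x) (by linarith)
      rw [sub_add_sub_cancel] at h1
      have h2 := ht s hs
      have h3 : Real.exp (κ * (s - x)) ≤ Real.exp (κ * δ) :=
        Real.exp_le_exp.2 (mul_le_mul_of_nonneg_left (by linarith) hκ)
      nlinarith [mul_le_mul_of_nonneg_right h3 (h0 (t - s)), Real.exp_pos (κ * δ)]
    refine le_of_tendsto (x := 𝓝[>] (0 : ℝ)) ?_
      (eventually_nhdsWithin_of_forall fun δ hδ => key δ hδ)
    have := (hexp.mul (hid.const_sub S₂)).mul_const (∑ j, p j * τ j)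
    simpa using this
  rw [integral_neg] at lower
  rw [Metric.tendsto_nhds]
  intro ε hε
  have e1 : S₁ ≤ (∫ s, z s) / ∑ j, p j * τ j := (le_div_iff₀ hm).2 upper
  have e2 : S₂ ≤ -((∫ s, z s) / ∑ j, p j * τ j) := by
    rw [← neg_div]; exact (le_div_iff₀ hm).2 lower
  filter_upwards [hS₁ (ε / 2) (by linarith), hS₂ (ε / 2) (by linarith)] with t h1 h2
  rw [Real.dist_eq, abs_lt]
  constructor <;> linarith

/-- Cesàro averages of a locally integrable function with a limit at `∞`. -/
theorem tendsto_average_of_tendsto {f : ℝ → ℝ} {c : ℝ}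
    (hf : ∀ a b, IntervalIntegrable f volume a b) (hc : Tendsto f atTop (𝓝 c)) :
    Tendsto (fun T => (∫ t in (0 : ℝ)..T, f t) / T) atTop (𝓝 c) := by
  rw [Metric.tendsto_nhds]
  intro ε hε
  obtain ⟨R, hR⟩ := eventually_atTop.1 (Metric.tendsto_nhds.1 hc (ε / 2) (half_pos hε))
  set K := |(∫ t in (0 : ℝ)..R, f t) - R * c| with hK
  filter_upwards [eventually_ge_atTop R, eventually_gt_atTop 0,
    eventually_gt_atTop ((K - R * (ε / 2)) / (ε / 2))] with T hTR hT0 hTK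
  have h1 : |(∫ t in R..T, f t) - (T - R) * c| ≤ ε / 2 * (T - R) := by
    have e : (∫ t in R..T, f t) - (T - R) * c = ∫ t in R..T, (f t - c) := by
      rw [intervalIntegral.integral_sub (hf _ _) (by simp)]
      simp
    rw [e, ← Real.norm_eq_abs]
    have := intervalIntegral.norm_integral_le_of_norm_le_const (a := R) (b := T)
      (f := fun t => f t - c) (C := ε / 2) fun t ht => by
        rw [Set.uIoc_of_le hTR] at ht
        exact (hR t ht.1.le).le
    rwa [abs_of_nonneg (sub_nonneg.2 hTR)] at this
  have h2 : ∫ t in (0 : ℝ)..T, f t = (∫ t in (0 : ℝ)..R, f t) + ∫ t in R..T, f t :=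
    (intervalIntegral.integral_add_adjacent_intervals (hf _ _) (hf _ _)).symm
  have h3 : |(∫ t in (0 : ℝ)..T, f t) - T * c| ≤ K + ε / 2 * (T - R) := by
    rw [h2]
    calc _ = |((∫ t in (0 : ℝ)..R, f t) - R * c) + ((∫ t in R..T, f t) - (T - R) * c)| := by
          congr 1; ring
      _ ≤ _ := (abs_add_le _ _).trans (by gcongr)
  rw [Real.dist_eq]
  have e3 : (∫ t in (0 : ℝ)..T, f t) / T - c = ((∫ t in (0 : ℝ)..T, f t) - T * c) / T := by
    field_simp
  rw [e3, abs_div, abs_of_pos hT0, div_lt_iff₀ hT0]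
  have h4 := (div_lt_iff₀ (half_pos hε)).1 hTK
  linarith

/-- Averaged renewal theorem. -/
theorem tendsto_average [Nonempty ι] (h : IsRenewalSolution p τ u z) {B : ℝ}
    (hB : ∀ t, |u t| ≤ B) :
    Tendsto (fun T => (∫ t in (0 : ℝ)..T, u t) / T) atTop
      (𝓝 ((∫ s, z s) / ∑ j, p j * τ j)) := by
  have hm : 0 < ∑ j, p j * τ j :=
    Finset.sum_pos (fun j _ => mul_pos (h.weight_pos j) (h.step_pos j)) Finset.univ_nonempty
  set W : ℝ → ℝ := fun t => ∫ s in (0 : ℝ)..t, u s with hW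
  have hWlip : ∀ a b, |W b - W a| ≤ B * |b - a| := by
    intro a b
    rw [hW, intervalIntegral.integral_interval_sub_left (h.intervalIntegrable _ _)
      (h.intervalIntegrable _ _)]
    exact intervalIntegral.norm_integral_le_of_norm_le_const (f := u) fun t _ => hB t
  have hWcont : Continuous W := intervalIntegral.continuous_primitive h.intervalIntegrable 0
  have hWint : ∀ a b, IntervalIntegrable W volume a b := fun a b => hWcont.intervalIntegrable a b
  have hZ : ∀ t, ∫ s in Set.Iic t, z s = ∑ j, p j * (W t - W (t - τ j)) := by
    intro t
    rw [← h.sum_window]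
    refine Finset.sum_congr rfl fun j _ => ?_
    rw [hW, intervalIntegral.integral_interval_sub_left (h.intervalIntegrable _ _)
      (h.intervalIntegrable _ _)]
  have hZint : ∀ a b, IntervalIntegrable (fun t => ∫ s in Set.Iic t, z s) volume a b := by
    intro a b
    simp_rw [hZ]
    exact Continuous.intervalIntegrable (by fun_prop) a b
  have hces := tendsto_average_of_tendsto hZint h.tendsto_setIntegral_Iic
  -- Integrating `sum_window` over `[0, T]` leaves `H T - H 0`. Since `W` is Lipschitz, `H T` is the
  -- mean step times `W T` up to a bounded error, which disappears after division by `T`. No density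
  -- of the steps is needed.
  set H : ℝ → ℝ := fun T => ∑ j, p j * ∫ t in (T - τ j)..T, W t with hH
  have hH' : ∀ T, ∫ t in (0 : ℝ)..T, (∫ s in Set.Iic t, z s) = H T - H 0 := by
    intro T
    simp_rw [hZ, hH]
    rw [intervalIntegral.integral_finsetSum fun j _ =>
      Continuous.intervalIntegrable (by fun_prop) _ _, ← Finset.sum_sub_distrib]
    refine Finset.sum_congr rfl fun j _ => ?_
    rw [intervalIntegral.integral_const_mul, ← mul_sub,
      intervalIntegral.integral_sub (hWint _ _) (Continuous.intervalIntegrable (by fun_prop) _ _),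
      intervalIntegral.integral_comp_sub_right (fun t => W t)]
    congr 1
    rw [intervalIntegral.integral_interval_sub_interval_comm (hWint _ _) (hWint _ _) (hWint _ _)]
    rw [intervalIntegral.integral_symm 0 (0 - τ j),
      intervalIntegral.integral_symm T (T - τ j)]
    ring
  set K := B * ∑ j, p j * τ j ^ 2 with hK
  have hHW : ∀ T, |H T - (∑ j, p j * τ j) * W T| ≤ K := by
    intro T
    rw [hH, hK, Finset.sum_mul, ← Finset.sum_sub_distrib, Finset.mul_sum]
    refine (Finset.abs_sum_le_sum_abs _ _).trans (Finset.sum_le_sum fun j _ => ?_)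
    have hτ := h.step_pos j
    have e : p j * (∫ t in (T - τ j)..T, W t) - p j * τ j * W T =
        p j * ∫ t in (T - τ j)..T, (W t - W T) := by
      rw [intervalIntegral.integral_sub (hWint _ _) (by simp)]
      simp
      ring
    rw [e, abs_mul, abs_of_pos (h.weight_pos j)]
    have : ‖∫ t in (T - τ j)..T, (W t - W T)‖ ≤ B * τ j * |T - (T - τ j)| := by
      refine intervalIntegral.norm_integral_le_of_norm_le_const fun t ht => ?_
      rw [Set.uIoc_of_le (by linarith)] at ht
      refine (hWlip T t).trans ?_
      have hB0 : 0 ≤ B := (abs_nonneg _).trans (hB 0)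
      refine mul_le_mul_of_nonneg_left ?_ hB0
      rw [abs_le]; constructor <;> linarith [ht.1, ht.2]
    rw [Real.norm_eq_abs, sub_sub_cancel, abs_of_pos hτ] at this
    calc p j * _ ≤ p j * (B * τ j * τ j) := mul_le_mul_of_nonneg_left this (h.weight_pos j).le
      _ = _ := by ring
  have herr : Tendsto (fun T => (H T - H 0 - (∑ j, p j * τ j) * W T) / T) atTop (𝓝 0) := by
    refine squeeze_zero_norm' (a := fun T => (K + |H 0|) / T) ?_
      (tendsto_const_nhds.div_atTop tendsto_id)
    filter_upwards [eventually_gt_atTop 0] with T hT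
    rw [norm_div, Real.norm_of_nonneg hT.le, Real.norm_eq_abs]
    gcongr
    calc _ = |(H T - (∑ j, p j * τ j) * W T) - H 0| := by congr 1; ring
      _ ≤ _ := (abs_sub _ _).trans (by gcongr; exact hHW T)
  have := ((hces.sub herr).div_const (∑ j, p j * τ j))
  rw [sub_zero] at this
  refine this.congr fun T => ?_
  rw [hH', ← sub_div]
  field_simp
  ring

/-- If a solution of an arithmetic renewal equation converges to `M` at `∞` and to `0` at `-∞`,
then the sums of the inhomogeneity over all cosets of the lattice agree. -/
theorem tendsto_sum_of_tendsto (h : IsRenewalSolution p τ u z) {k : ι → ℕ} {d M : ℝ} (hd : 0 < d)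
    (hk : ∀ j, τ j = k j * d) (htop : Tendsto u atTop (𝓝 M)) (hbot : Tendsto u atBot (𝓝 0))
    (t : ℝ) :
    Tendsto (fun n : ℕ => ∑ i ∈ Finset.range (2 * n + 1), z (t - n * d + i * d)) atTop
      (𝓝 (M * ∑ j, p j * k j)) := by
  -- Discrete analogue of the window integrals: cutting each step `k j * d` into steps `d` writes
  -- `z` as the difference of `V` over one period, so sums of `z` along a coset telescope.
  set V : ℝ → ℝ := fun t => ∑ j, p j * ∑ i ∈ Finset.range (k j), u (t - i * d) with hV
  have hstep : ∀ t, z t = V t - V (t - d) := by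
    intro t
    have h1 : ∀ j, ∑ i ∈ Finset.range (k j), u (t - i * d) -
        ∑ i ∈ Finset.range (k j), u (t - d - i * d) = u t - u (t - τ j) := by
      intro j
      rw [← Finset.sum_sub_distrib]
      have := Finset.sum_range_sub' (fun i : ℕ => u (t - i * d)) (k j)
      simp only [Nat.cast_zero, zero_mul, sub_zero] at this
      rw [hk j, ← this]
      refine Finset.sum_congr rfl fun i _ => ?_
      push_cast
      congr 2
      ring
    rw [hV, ← Finset.sum_sub_distrib]
    simp_rw [← mul_sub, h1, mul_sub]
    rw [Finset.sum_sub_distrib, ← Finset.sum_mul, h.weight_sum, one_mul]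
    linarith [h.eq t]
  have htel : ∀ n : ℕ, ∑ i ∈ Finset.range (2 * n + 1), z (t - n * d + i * d) =
      V (t + n * d) - V (t - n * d - d) := by
    intro n
    have := Finset.sum_range_sub (fun i : ℕ => V (t - n * d - d + i * d)) (2 * n + 1)
    simp only [Nat.cast_zero, zero_mul, add_zero] at this
    rw [show t + n * d = t - n * d - d + ((2 * n + 1 : ℕ) : ℝ) * d by push_cast; ring, ← this]
    refine Finset.sum_congr rfl fun i _ => ?_
    rw [hstep]
    push_cast
    congr 2 <;> ring
  have hlim : ∀ (c : ℝ) (l : Filter ℝ), (∀ a : ℝ, Tendsto (fun t => u (t - a)) l (𝓝 c)) →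
      Tendsto V l (𝓝 (c * ∑ j, p j * k j)) := by
    intro c l hl
    have : Tendsto V l (𝓝 (∑ j, p j * ∑ _i ∈ Finset.range (k j), c)) :=
      tendsto_finsetSum _ fun j _ => (tendsto_finsetSum _ fun i _ => hl _).const_mul _
    convert this using 2
    rw [Finset.mul_sum]
    refine Finset.sum_congr rfl fun j _ => ?_
    simp
    ring
  have hVtop := hlim M atTop fun a =>
    htop.comp (tendsto_atTop_add_const_right atTop (-a) tendsto_id)
  have hVbot := hlim 0 atBot fun a =>
    hbot.comp (tendsto_atBot_add_const_right atBot (-a) tendsto_id)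
  have hnd : Tendsto (fun n : ℕ => (n : ℝ) * d) atTop atTop :=
    tendsto_natCast_atTop_atTop.atTop_mul_const hd
  have h1 : Tendsto (fun n : ℕ => t + n * d) atTop atTop :=
    tendsto_atTop_add_const_left _ _ hnd
  have h2 : Tendsto (fun n : ℕ => t - n * d - d) atTop atBot := by
    have := tendsto_atBot_add_const_left atTop (t - d) (tendsto_neg_atTop_atBot.comp hnd)
    refine this.congr fun n => ?_
    simp
    ring
  have := (hVtop.comp h1).sub (hVbot.comp h2)
  simp only [zero_mul, sub_zero] at this
  exact this.congr fun n => (htel n).symm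

end IsRenewalSolution

/-! ### Similitudes of the line -/

/-- The distances of `f x` from `f 0` and `f 1` determine `f x`: subtracting the two squared
identities leaves a linear equation. -/
theorem exists_eq_mul_add_of_dist_map {f : ℝ → ℝ} {r : ℝ} (hr : 0 < r)
    (hf : ∀ x y, dist (f x) (f y) = r * dist x y) :
    ∃ s c : ℝ, |s| = r ∧ ∀ x, f x = s * x + c := by
  have hsq : ∀ x y, (f x - f y) ^ 2 = r ^ 2 * (x - y) ^ 2 := by
    intro x y
    have := hf x y
    rw [Real.dist_eq, Real.dist_eq] at this
    rw [← sq_abs (f x - f y), this, mul_pow, sq_abs]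
  have h10 := hsq 1 0
  set s := f 1 - f 0 with hs
  have hs2 : s ^ 2 = r ^ 2 := by rw [h10]; ring
  have hs0 : s ≠ 0 := by
    intro h0
    rw [h0] at hs2
    have : 0 < r ^ 2 := by positivity
    linarith
  refine ⟨s, f 0, ?_, fun x => ?_⟩
  · rw [← abs_of_pos hr]
    exact sq_eq_sq_iff_abs_eq_abs _ _ |>.1 hs2
  · have h0 := hsq x 0
    have h1 := hsq x 1
    have e : f 1 = f 0 + s := by rw [hs]; ring
    rw [e] at h1
    have key : (f x - f 0 - s * x) * s = 0 := by linear_combination (h0 - h1) / 2 + (1/2 - x) * hs2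
    have := (mul_eq_zero.1 key).resolve_right hs0
    linarith

open Pointwise in
theorem volume_real_image_affine (s c : ℝ) (A : Set ℝ) :
    volume.real ((fun x => s * x + c) '' A) = |s| * volume.real A := by
  have : (fun x => s * x + c) '' A = (fun x => x + c) '' (s • A) := by
    rw [← Set.image_smul, Set.image_image]
    rfl
  rw [this, Set.image_add_right, measureReal_def, measure_preimage_add_right,
    Measure.addHaar_smul, ENNReal.toReal_mul, ENNReal.toReal_ofReal (abs_nonneg _)]
  simp [measureReal_def]

theorem image_affine_Icc_min_max {s c a b : ℝ} (hs : s ≠ 0) (hab : a ≤ b) :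
    (fun x => s * x + c) '' Set.Icc a b =
      Set.Icc (min (s * a + c) (s * b + c)) (max (s * a + c) (s * b + c)) := by
  rcases lt_or_gt_of_ne hs with h | h
  · have hle : s * b + c ≤ s * a + c := by nlinarith
    rw [min_eq_right hle, max_eq_left hle]
    ext y
    simp only [Set.mem_image, Set.mem_Icc]
    constructor
    · rintro ⟨x, hx, rfl⟩; constructor <;> nlinarith [hx.1, hx.2]
    · intro hy
      refine ⟨(y - c) / s, ⟨?_, ?_⟩, by field_simp; ring⟩
      · rw [le_div_iff_of_neg h]; linarith [hy.2]
      · rw [div_le_iff_of_neg h]; linarith [hy.1]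
  · have hle : s * a + c ≤ s * b + c := by nlinarith
    rw [min_eq_left hle, max_eq_right hle]
    exact Set.image_affine_Icc' h c a b

theorem image_affine_Ioo_min_max {s c a b : ℝ} (hs : s ≠ 0) (hab : a ≤ b) :
    (fun x => s * x + c) '' Set.Ioo a b =
      Set.Ioo (min (s * a + c) (s * b + c)) (max (s * a + c) (s * b + c)) := by
  rcases lt_or_gt_of_ne hs with h | h
  · have hle : s * b + c ≤ s * a + c := by nlinarith
    rw [min_eq_right hle, max_eq_left hle]
    ext y
    simp only [Set.mem_image, Set.mem_Ioo]
    constructor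
    · rintro ⟨x, hx, rfl⟩; constructor <;> nlinarith [hx.1, hx.2]
    · intro hy
      refine ⟨(y - c) / s, ⟨?_, ?_⟩, by field_simp; ring⟩
      · rw [lt_div_iff_of_neg h]; linarith [hy.2]
      · rw [div_lt_iff_of_neg h]; linarith [hy.1]
  · have hle : s * a + c ≤ s * b + c := by nlinarith
    rw [min_eq_left hle, max_eq_right hle]
    exact Set.image_affine_Ioo h c a b

theorem IsCompact.convexHull_eq_Icc {F : Set ℝ} (hF : IsCompact F) (hne : F.Nonempty) :
    convexHull ℝ F = Set.Icc (sInf F) (sSup F) := by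
  refine Set.Subset.antisymm (convexHull_min (fun x hx => ⟨csInf_le hF.bddBelow hx,
    le_csSup hF.bddAbove hx⟩) (convex_Icc _ _)) ?_
  exact (convex_convexHull ℝ F).ordConnected.out
    (subset_convexHull ℝ F (hF.sInf_mem hne)) (subset_convexHull ℝ F (hF.sSup_mem hne))

/-! ### Open intervals: inradius and inner tubes -/

theorem inradius_Ioo {x y : ℝ} (hxy : x < y) : inradius (Set.Ioo x y) = (y - x) / 2 := by
  have : {ρ : ℝ | 0 < ρ ∧ ∃ c, Metric.ball c ρ ⊆ Set.Ioo x y} = Set.Ioc 0 ((y - x) / 2) := by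
    ext ρ
    simp only [Set.mem_ofPred_eq, Set.mem_Ioc, Real.ball_eq_Ioo]
    refine and_congr_right fun hρ => ⟨?_, fun h => ⟨(x + y) / 2, ?_⟩⟩
    · rintro ⟨c, hc⟩
      rw [Set.Ioo_subset_Ioo_iff (by linarith)] at hc
      linarith
    · exact Set.Ioo_subset_Ioo (by linarith) (by linarith)
  rw [inradius, this, csSup_Ioc (by linarith)]

theorem volume_real_Icc_near_ends {x y ε : ℝ} (hxy : x ≤ y) (hε : 0 ≤ ε) :
    volume.real {z | z ∈ Set.Icc x y ∧ (z - x ≤ ε ∨ y - z ≤ ε)} = min (2 * ε) (y - x) := by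
  have : {z | z ∈ Set.Icc x y ∧ (z - x ≤ ε ∨ y - z ≤ ε)} =
      Set.Icc x y \ Set.Ioo (x + ε) (y - ε) := by
    ext z
    simp only [Set.mem_ofPred_eq, Set.mem_sdiff, Set.mem_Ioo, not_and_or, not_lt]
    refine and_congr_right fun _ => or_congr ?_ ?_ <;> constructor <;> intro h <;> linarith
  have hsub : Set.Ioo (x + ε) (y - ε) ⊆ Set.Icc x y :=
    fun z hz => ⟨by linarith [hz.1], by linarith [hz.2]⟩
  rw [this, measureReal_sdiff hsub measurableSet_Ioo (by simp), Real.volume_real_Icc_of_le hxy, Real.volume_real_Ioo]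
  rcases le_total (2 * ε) (y - x) with h | h
  · rw [min_eq_left h, max_eq_left (by linarith)]; ring
  · rw [min_eq_right h, max_eq_right (by linarith)]; ring

theorem infDist_compl_Ioo_le_iff {x y z ε : ℝ} (hz : z ∈ Set.Icc x y) :
    Metric.infDist z (Set.Ioo x y)ᶜ ≤ ε ↔ z - x ≤ ε ∨ y - z ≤ ε := by
  have hx : x ∈ (Set.Ioo x y)ᶜ := by simp
  have hy : y ∈ (Set.Ioo x y)ᶜ := by simp
  constructor
  · intro h
    have hc : IsClosed (Set.Ioo x y)ᶜ := isOpen_Ioo.isClosed_compl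
    obtain ⟨w, hw, hwz⟩ := hc.exists_infDist_eq_dist ⟨x, hx⟩ z
    rw [hwz, Real.dist_eq, abs_le] at h
    by_cases hxw : w ≤ x
    · left; linarith [h.2]
    · right
      have : y ≤ w := by
        by_contra! h'
        exact hw ⟨not_le.1 hxw, h'⟩
      linarith [h.1]
  · rintro (h | h)
    · refine (Metric.infDist_le_dist_of_mem hx).trans ?_
      rwa [Real.dist_eq, abs_of_nonneg (by linarith [hz.1])]
    · refine (Metric.infDist_le_dist_of_mem hy).trans ?_
      rwa [Real.dist_eq, abs_sub_comm, abs_of_nonneg (by linarith [hz.2])]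

theorem innerTubeVolume_Ioo {x y ε : ℝ} (hxy : x < y) (hε : 0 ≤ ε) :
    innerTubeVolume (Set.Ioo x y) ε = min (2 * ε) (y - x) := by
  rw [innerTubeVolume, ← volume_real_Icc_near_ends hxy.le hε, closure_Ioo hxy.ne]
  congr 1
  ext z
  exact and_congr_right fun hz => infDist_compl_Ioo_le_iff hz

/-- Each of the two endpoints carries a collar of length ε until the collars meet at the midpoint.
Only the values at 0 and 1 of the coefficient function matter. -/
theorem isSteinerLike_Ioo {x y : ℝ} (hxy : x < y) :
    IsSteinerLike (Set.Ioo x y) (fun m => if m = 0 then 2 else -(y - x)) where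
  isOpen := isOpen_Ioo
  isBounded := Metric.isBounded_Ioo x y
  tube_of_lt ε h0 hε := by
    rw [inradius_Ioo hxy] at hε
    rw [innerTubeVolume_Ioo hxy h0.le, min_eq_left (by linarith)]
    simp
  tube_of_ge ε hε := by
    rw [inradius_Ioo hxy] at hε
    rw [innerTubeVolume_Ioo hxy (by linarith), min_eq_right (by linarith),
      Real.volume_real_Ioo_of_le hxy.le]
  coeff_top := by simp [Real.volume_real_Ioo_of_le hxy.le]

/-! ### The complement of finitely many intervals -/

/-- Finitely many nondegenerate non-overlapping closed intervals in `[a, b]` that contain `a`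
and `b`. -/
structure IsIntervalPacking {J : ℕ} (a b : ℝ) (lo hi : Fin J → ℝ) : Prop where
  lt : ∀ j, lo j < hi j
  le_lo : ∀ j, a ≤ lo j
  hi_le : ∀ j, hi j ≤ b
  separated : ∀ i j, i ≠ j → hi i ≤ lo j ∨ hi j ≤ lo i
  exists_lo : ∃ j, lo j = a
  exists_hi : ∃ j, hi j = b

namespace IsIntervalPacking

variable {J : ℕ} {a b : ℝ} {lo hi : Fin J → ℝ}

/-- The component ends at the nearest interval on each side; these exist because some interval
starts at `a` and some interval ends at `b`. -/
theorem exists_connectedComponentIn_eq_Ioo (h : IsIntervalPacking a b lo hi) {p : ℝ}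
    (hp : p ∈ Set.Icc a b \ ⋃ j, Set.Icc (lo j) (hi j)) :
    ∃ i j, hi i < p ∧ p < lo j ∧
      connectedComponentIn (Set.Icc a b \ ⋃ j, Set.Icc (lo j) (hi j)) p =
        Set.Ioo (hi i) (lo j) := by
  set T := Set.Icc a b \ ⋃ j, Set.Icc (lo j) (hi j) with hT
  obtain ⟨⟨hap, hpb⟩, hpU⟩ := hp
  simp only [Set.mem_iUnion, Set.mem_Icc, not_exists, not_and_or, not_le] at hpU
  obtain ⟨j₀, hj₀⟩ := h.exists_lo
  obtain ⟨j₁, hj₁⟩ := h.exists_hi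
  have hne₀ : (Finset.univ.filter fun j => hi j < p).Nonempty :=
    ⟨j₀, by
      have := hpU j₀
      rw [hj₀] at this
      simpa using this.resolve_left (not_lt.2 hap)⟩
  have hne₁ : (Finset.univ.filter fun j => p < lo j).Nonempty :=
    ⟨j₁, by
      have := hpU j₁
      rw [hj₁] at this
      simpa using this.resolve_right (not_lt.2 hpb)⟩
  obtain ⟨i, hi₁, hi₂⟩ := Finset.exists_max_image _ hi hne₀
  obtain ⟨j, hj₁, hj₂⟩ := Finset.exists_min_image _ lo hne₁
  simp only [Finset.mem_filter, Finset.mem_univ, true_and] at hi₁ hi₂ hj₁ hj₂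
  refine ⟨i, j, hi₁, hj₁, Set.Subset.antisymm ?_ ?_⟩
  · intro z hz
    have hpT : p ∈ T := by
      refine ⟨⟨hap, hpb⟩, ?_⟩
      simpa [imp_iff_not_or] using hpU
    have hoc := (isPreconnected_connectedComponentIn (F := T) (x := p)).ordConnected
    have hpm := mem_connectedComponentIn hpT
    have hsub := connectedComponentIn_subset T p
    constructor
    · by_contra! hle
      exact (hsub (hoc.out hz hpm ⟨hle, hi₁.le⟩)).2
        (Set.mem_iUnion.2 ⟨i, (h.lt i).le, le_rfl⟩)
    · by_contra! hle
      exact (hsub (hoc.out hpm hz ⟨hj₁.le, hle⟩)).2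
        (Set.mem_iUnion.2 ⟨j, le_rfl, (h.lt j).le⟩)
  · refine isPreconnected_Ioo.subset_connectedComponentIn ⟨hi₁, hj₁⟩ fun z hz => ⟨⟨?_, ?_⟩, ?_⟩
    · exact ((h.le_lo i).trans (h.lt i).le).trans hz.1.le
    · exact hz.2.le.trans ((h.lt j).le.trans (h.hi_le j))
    · simp only [Set.mem_iUnion, not_exists]
      intro k hk
      rcases hpU k with hk' | hk'
      · exact absurd hk.1 (not_le.2 (hz.2.trans_le (hj₂ k hk')))
      · exact absurd hk.2 (not_le.2 ((hi₂ k hk').trans_lt hz.1))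

/-- The components of the complement are at most `J - 1` open intervals. -/
theorem exists_enumeration (h : IsIntervalPacking a b lo hi)
    (hne : (Set.Icc a b \ ⋃ j, Set.Icc (lo j) (hi j)).Nonempty) :
    ∃ (Q : ℕ) (x y : Fin Q → ℝ), 0 < Q ∧ Q ≤ J - 1 ∧ (∀ q, x q < y q) ∧
      (∀ q, x q ∈ Set.range hi) ∧ (∀ q, y q ∈ Set.range lo) ∧
      Function.Injective (fun q => Set.Ioo (x q) (y q)) ∧
      Set.range (fun q => Set.Ioo (x q) (y q)) =
        {G | ∃ p ∈ Set.Icc a b \ ⋃ j, Set.Icc (lo j) (hi j),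
          G = connectedComponentIn (Set.Icc a b \ ⋃ j, Set.Icc (lo j) (hi j)) p} ∧
      (⋃ q, Set.Ioo (x q) (y q)) = Set.Icc a b \ ⋃ j, Set.Icc (lo j) (hi j) ∧
      Pairwise (Function.onFun Disjoint fun q => Set.Ioo (x q) (y q)) := by
  classical
  set T := Set.Icc a b \ ⋃ j, Set.Icc (lo j) (hi j) with hT
  set S : Set (Set ℝ) := {G | ∃ p ∈ T, G = connectedComponentIn T p} with hS
  have hSI : ∀ G ∈ S, ∃ i j, hi i < lo j ∧ a < lo j ∧ G = Set.Ioo (hi i) (lo j) := by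
    rintro G ⟨p, hp, rfl⟩
    obtain ⟨i, j, hip, hpj, e⟩ := h.exists_connectedComponentIn_eq_Ioo hp
    exact ⟨i, j, hip.trans hpj, hp.1.1.trans_lt hpj, e⟩
  have hmeet : ∀ G ∈ S, ∀ G' ∈ S, (G ∩ G').Nonempty → G = G' := by
    rintro _ ⟨p, hp, rfl⟩ _ ⟨p', hp', rfl⟩ ⟨w, hw, hw'⟩
    rw [connectedComponentIn_eq hw, connectedComponentIn_eq hw']
  have : Nonempty (Fin J) := ⟨h.exists_lo.choose⟩
  choose! i j hij haj hG using hSI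
  -- Two gaps with the same right end overlap just to the left of it, so a gap is determined by the
  -- interval that bounds it on the right.
  have hjinj : Set.InjOn j S := by
    intro G hGS G' hGS' e
    refine hmeet G hGS G' hGS' ?_
    rw [hG G hGS, hG G' hGS', e]
    obtain ⟨w, hw1, hw2⟩ := exists_between (max_lt (e ▸ hij G hGS) (hij G' hGS'))
    exact ⟨w, ⟨(le_max_left _ _).trans_lt hw1, hw2⟩, ⟨(le_max_right _ _).trans_lt hw1, hw2⟩⟩
  have hfin : S.Finite := Set.Finite.of_finite_image (Set.toFinite (j '' S)) hjinj
  obtain ⟨j₀, hj₀⟩ := h.exists_lo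
  -- The interval that starts at `a` bounds no gap on the right, which saves one.
  have hcard : S.ncard ≤ J - 1 := by
    have h1 : S.ncard ≤ ({j₀}ᶜ : Set (Fin J)).ncard :=
      Set.ncard_le_ncard_of_injOn j (fun G hGS => by
        intro hh
        rw [Set.mem_singleton_iff] at hh
        have := haj G hGS
        rw [hh, hj₀] at this
        exact lt_irrefl _ this) hjinj (Set.toFinite _)
    rwa [Set.ncard_compl, Set.ncard_singleton, Nat.card_fin] at h1
  have hcard0 : 0 < S.ncard := by
    obtain ⟨p, hp⟩ := hne
    exact (Set.ncard_pos hfin).2 ⟨_, p, hp, rfl⟩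
  have := hfin.fintype
  have hcardeq : Fintype.card S = S.ncard := by
    rw [← Nat.card_eq_fintype_card, Nat.card_coe_set_eq]
  let e : Fin S.ncard ≃ S := (finCongr hcardeq.symm).trans (Fintype.equivFin S).symm
  have heq : ∀ q, Set.Ioo (hi (i (e q))) (lo (j (e q))) = e q := fun q => (hG _ (e q).2).symm
  have hinj : Function.Injective fun q => Set.Ioo (hi (i (e q))) (lo (j (e q))) := by
    simp_rw [heq]
    exact Subtype.val_injective.comp e.injective
  have hrange : Set.range (fun q => Set.Ioo (hi (i (e q))) (lo (j (e q)))) = S := by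
    simp_rw [heq]
    ext G
    constructor
    · rintro ⟨q, rfl⟩; exact (e q).2
    · intro hGS; exact ⟨e.symm ⟨G, hGS⟩, by simp⟩
  refine ⟨S.ncard, fun q => hi (i (e q)), fun q => lo (j (e q)), hcard0, hcard,
    fun q => hij _ (e q).2, fun q => ⟨_, rfl⟩, fun q => ⟨_, rfl⟩, hinj, hrange, ?_, ?_⟩
  · rw [← Set.sUnion_range, hrange]
    ext w
    constructor
    · rintro ⟨G, ⟨p, hp, rfl⟩, hw⟩
      exact connectedComponentIn_subset _ _ hw
    · intro hw
      exact ⟨_, ⟨w, hw, rfl⟩, mem_connectedComponentIn hw⟩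
  · intro q q' hqq'
    rw [Function.onFun, Set.disjoint_iff_inter_eq_empty, ← Set.not_nonempty_iff_eq_empty]
    intro hn
    refine hqq' (hinj ?_)
    simp only [heq] at hn ⊢
    exact hmeet _ (e q).2 _ (e q').2 hn

/-- Length in `[a, b]` splits over the intervals and the gaps. -/
theorem volume_real_inter_Icc (h : IsIntervalPacking a b lo hi) {Q : ℕ} {x y : Fin Q → ℝ}
    (hU : (⋃ q, Set.Ioo (x q) (y q)) = Set.Icc a b \ ⋃ j, Set.Icc (lo j) (hi j))
    (hd : Pairwise (Function.onFun Disjoint fun q => Set.Ioo (x q) (y q))) {A : Set ℝ}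
    (hA : MeasurableSet A) :
    volume.real (A ∩ Set.Icc a b) = ∑ j, volume.real (A ∩ Set.Icc (lo j) (hi j)) +
      ∑ q, volume.real (A ∩ Set.Ioo (x q) (y q)) := by
  let f : Fin J ⊕ Fin Q → Set ℝ :=
    Sum.elim (fun j => A ∩ Set.Icc (lo j) (hi j)) (fun q => A ∩ Set.Ioo (x q) (y q))
  have hIcc : ∀ j, Set.Icc (lo j) (hi j) ⊆ Set.Icc a b := fun j =>
    Set.Icc_subset_Icc (h.le_lo j) (h.hi_le j)
  have hf : A ∩ Set.Icc a b = ⋃ i, f i := by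
    rw [Set.iUnion_sum]
    simp only [f, Sum.elim_inl, Sum.elim_inr]
    rw [← Set.inter_iUnion, ← Set.inter_iUnion, ← Set.inter_union_distrib_left, hU,
      Set.union_sdiff_cancel (Set.iUnion_subset hIcc)]
  have hGI : ∀ j q, Disjoint (Set.Icc (lo j) (hi j)) (Set.Ioo (x q) (y q)) := by
    intro j q
    rw [Set.disjoint_left]
    intro w hw hw'
    have : w ∈ Set.Icc a b \ ⋃ j, Set.Icc (lo j) (hi j) := hU ▸ Set.mem_iUnion.2 ⟨q, hw'⟩
    exact this.2 (Set.mem_iUnion.2 ⟨j, hw⟩)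
  -- Adjacent closed intervals may share an endpoint, so disjointness holds only up to null sets.
  have hdisj : Pairwise (Function.onFun (AEDisjoint volume) f) := by
    rintro (j | q) (j' | q') hne
    · have hjj : j ≠ j' := fun e => hne (by rw [e])
      have hsub : f (Sum.inl j) ∩ f (Sum.inl j') ⊆ {hi j, hi j'} := by
        rintro w ⟨⟨-, hw⟩, ⟨-, hw'⟩⟩
        rcases h.separated j j' hjj with hs | hs
        · left; exact le_antisymm hw.2 (hs.trans hw'.1)
        · right; exact le_antisymm hw'.2 (hs.trans hw.1)
      exact measure_mono_null hsub ((Set.toFinite _).measure_zero _)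
    · exact ((hGI j q').mono Set.inter_subset_right Set.inter_subset_right).aedisjoint
    · exact ((hGI j' q).symm.mono Set.inter_subset_right Set.inter_subset_right).aedisjoint
    · exact ((hd fun e => hne (by rw [e])).mono
        Set.inter_subset_right Set.inter_subset_right).aedisjoint
  have hm : ∀ i, NullMeasurableSet (f i) := by
    rintro (j | q)
    · exact (hA.inter measurableSet_Icc).nullMeasurableSet
    · exact (hA.inter measurableSet_Ioo).nullMeasurableSet
  have hfi : ∀ i, volume (f i) ≠ ⊤ := by
    rintro (j | q)
    · exact measure_ne_top_of_subset Set.inter_subset_right (by simp)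
    · exact measure_ne_top_of_subset Set.inter_subset_right (by simp)
  rw [hf, measureReal_def, measure_iUnion₀ hdisj hm, tsum_fintype,
    ENNReal.toReal_sum fun i _ => hfi i, Fintype.sum_sum_type]
  rfl

end IsIntervalPacking

/-! ### The self-similar set and its tube function -/

theorem IsCompact.mem_cthickening_iff {X : Type*} [PseudoMetricSpace X] {F : Set X}
    (hF : IsCompact F) {ε : ℝ} (hε : 0 ≤ ε) {w : X} :
    w ∈ Metric.cthickening ε F ↔ ∃ f ∈ F, dist w f ≤ ε := by
  rw [hF.cthickening_eq_biUnion_closedBall hε]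
  simp

/-- The extreme points of the hull belong to `F`, so outside the hull the neighborhood is two
collars of length exactly ε. -/
theorem tubeVolume_eq_add {F : Set ℝ} (hF : IsCompact F) (hne : F.Nonempty) {ε : ℝ}
    (hε : 0 ≤ ε) :
    tubeVolume F ε =
      volume.real (Metric.cthickening ε F ∩ Set.Icc (sInf F) (sSup F)) + 2 * ε := by
  set a := sInf F with ha
  set b := sSup F with hb
  have haF : a ∈ F := hF.sInf_mem hne
  have hbF : b ∈ F := hF.sSup_mem hne
  have hFab : ∀ f ∈ F, a ≤ f ∧ f ≤ b := fun f hf =>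
    ⟨csInf_le hF.bddBelow hf, le_csSup hF.bddAbove hf⟩
  have hsplit : Metric.cthickening ε F \ Set.Icc a b = Set.Ico (a - ε) a ∪ Set.Ioc b (b + ε) := by
    ext w
    simp only [Set.mem_sdiff, hF.mem_cthickening_iff hε, Set.mem_union, Set.mem_Ico, Set.mem_Ioc,
      Set.mem_Icc, not_and_or, not_le, Real.dist_eq, abs_le]
    constructor
    · rintro ⟨⟨f, hf, h1, h2⟩, h | h⟩
      · exact Or.inl ⟨by linarith [(hFab f hf).1], h⟩
      · exact Or.inr ⟨h, by linarith [(hFab f hf).2]⟩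
    · rintro (⟨h1, h2⟩ | ⟨h1, h2⟩)
      · exact ⟨⟨a, haF, by linarith, by linarith⟩, Or.inl h2⟩
      · exact ⟨⟨b, hbF, by linarith, by linarith⟩, Or.inr h1⟩
  have hfin : volume (Metric.cthickening ε F) ≠ ⊤ :=
    (hF.isBounded.cthickening).measure_lt_top.ne
  have hab : a ≤ b := (hFab a haF).2
  have hdis : Disjoint (Set.Ico (a - ε) a) (Set.Ioc b (b + ε)) := by
    rw [Set.disjoint_left]
    intro w h1 h2
    linarith [h1.2, h2.1]
  rw [tubeVolume, ← measureReal_inter_add_sdiff measurableSet_Icc hfin, hsplit,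
    measureReal_union hdis measurableSet_Ioc (by simp) (by simp),
    Real.volume_real_Ico_of_le (by linarith), Real.volume_real_Ioc_of_le (by linarith)]
  ring

theorem volume_real_cthickening_inter_Ioo {F : Set ℝ} (hF : IsCompact F) {x y ε : ℝ} (hxy : x < y)
    (hε : 0 ≤ ε) (hx : x ∈ F) (hy : y ∈ F) (hFxy : Disjoint F (Set.Ioo x y)) :
    volume.real (Metric.cthickening ε F ∩ Set.Ioo x y) = min (2 * ε) (y - x) := by
  have h1 : volume.real (Metric.cthickening ε F ∩ Set.Ioo x y) =
      volume.real (Metric.cthickening ε F ∩ Set.Icc x y) :=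
    measureReal_congr ((ae_eq_refl _).inter Ioo_ae_eq_Icc)
  rw [h1, ← volume_real_Icc_near_ends hxy.le hε]
  congr 1
  ext z
  rw [Set.mem_inter_iff, and_comm]
  refine and_congr_right fun hz => ?_
  rw [hF.mem_cthickening_iff hε]
  constructor
  · rintro ⟨f, hf, hzf⟩
    rw [Real.dist_eq, abs_le] at hzf
    by_cases hfx : f ≤ x
    · left; linarith
    · right
      have : y ≤ f := by
        by_contra! hfy
        exact Set.disjoint_left.1 hFxy hf ⟨not_le.1 hfx, hfy⟩
      linarith
  · rintro (h | h)
    · exact ⟨x, hx, by rwa [Real.dist_eq, abs_of_nonneg (by linarith [hz.1])]⟩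
    · exact ⟨y, hy, by rwa [Real.dist_eq, abs_sub_comm, abs_of_nonneg (by linarith [hz.2])]⟩

/-- A point of `F` outside `f '' F` lies beyond `lo` or `hi`. These belong to `f '' F` and are
closer to every point of `[lo, hi]`, so only the scaled copy of `F` is seen from there. -/
theorem cthickening_inter_image_eq {F : Set ℝ} (hF : IsCompact F) {f : ℝ → ℝ} {r ε lo hi : ℝ}
    (hr : 0 < r) (hf : ∀ x y, dist (f x) (f y) = r * dist x y) (hε : 0 ≤ ε) {I : Set ℝ}
    (hI : f '' I = Set.Icc lo hi) (hlo : lo ∈ f '' F) (hhi : hi ∈ f '' F) (hfF : f '' F ⊆ F)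
    (hout : ∀ w ∈ F, w ∈ f '' F ∨ w ≤ lo ∨ hi ≤ w) :
    Metric.cthickening ε F ∩ Set.Icc lo hi = f '' (Metric.cthickening (ε / r) F ∩ I) := by
  have hεr : 0 ≤ ε / r := by positivity
  ext w
  constructor
  · rintro ⟨hw, hwI⟩
    obtain ⟨g, hg, hwg⟩ := (hF.mem_cthickening_iff hε).1 hw
    have key : ∃ g' ∈ F, dist w (f g') ≤ ε := by
      rw [Real.dist_eq, abs_le] at hwg
      rcases hout g hg with ⟨g', hg', rfl⟩ | h | h
      · exact ⟨g', hg', by rw [Real.dist_eq, abs_le]; exact hwg⟩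
      · obtain ⟨g', hg', rfl⟩ := hlo
        exact ⟨g', hg', by
          rw [Real.dist_eq, abs_le]; constructor <;> linarith [hwI.1, hwg.1, hwg.2]⟩
      · obtain ⟨g', hg', rfl⟩ := hhi
        exact ⟨g', hg', by
          rw [Real.dist_eq, abs_le]; constructor <;> linarith [hwI.2, hwg.1, hwg.2]⟩
    obtain ⟨g', hg', hd⟩ := key
    obtain ⟨w', hw', rfl⟩ := hI.symm ▸ hwI
    refine ⟨w', ⟨(hF.mem_cthickening_iff hεr).2 ⟨g', hg', ?_⟩, hw'⟩, rfl⟩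
    rw [hf] at hd
    rwa [le_div_iff₀' hr]
  · rintro ⟨w', ⟨hw', hwI⟩, rfl⟩
    obtain ⟨g, hg, hwg⟩ := (hF.mem_cthickening_iff hεr).1 hw'
    refine ⟨(hF.mem_cthickening_iff hε).2 ⟨f g, hfF ⟨g, hg, rfl⟩, ?_⟩, hI ▸ ⟨w', hwI, rfl⟩⟩
    rw [hf]
    rwa [le_div_iff₀' hr] at hwg

/-- The generators of a self-similar tiling of the line and the functional equation of the
tube function of the self-similar set. -/
theorem exists_generators_and_tube {J : ℕ} {φ : Fin J → ℝ → ℝ} {r : Fin J → ℝ}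
    (hφ : IsSimilitudeSystem φ r) {F : Set ℝ} (hF : IsSelfSimilarSet φ F)
    (hTSC : TilesetCondition φ F) (hNTC : NontrivialityCondition φ F) :
    ∃ (Q : ℕ) (x y : Fin Q → ℝ) (v : ℝ → ℝ) (L : ℝ), 0 < Q ∧ Q ≤ J - 1 ∧ (∀ q, x q < y q) ∧
      Function.Injective (fun q => Set.Ioo (x q) (y q)) ∧
      Set.range (fun q => Set.Ioo (x q) (y q)) = generators φ F ∧
      ∑ j, r j < 1 ∧
      (∀ ε > 0, tubeVolume F ε = v ε + 2 * ε) ∧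
      Monotone v ∧ (∀ ε, 0 ≤ v ε) ∧ (∀ ε, v ε ≤ L) ∧
      ∀ ε > 0, v ε = ∑ j, r j * v (ε / r j) + ∑ q, min (2 * ε) (y q - x q) := by
  obtain ⟨hFc, hFne, hFeq⟩ := hF
  set a := sInf F with ha
  set b := sSup F with hb
  have hC : convexHull ℝ F = Set.Icc a b := hFc.convexHull_eq_Icc hFne
  have haF : a ∈ F := hFc.sInf_mem hFne
  have hbF : b ∈ F := hFc.sSup_mem hFne
  have hFab : F ⊆ Set.Icc a b := hC ▸ subset_convexHull ℝ F
  unfold TilesetCondition at hTSC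
  unfold NontrivialityCondition at hNTC
  simp only [hC, interior_Icc] at hTSC hNTC
  have hab : a < b := Set.nonempty_Ioo.1 hTSC.nonempty
  choose s c hsr hsc using fun j =>
    exists_eq_mul_add_of_dist_map (hφ.ratio_pos j) (hφ.dist_map j)
  have hs0 : ∀ j, s j ≠ 0 := fun j h0 => by
    have := hsr j
    rw [h0, abs_zero] at this
    exact (hφ.ratio_pos j).ne this
  have hφe : ∀ j, φ j = fun x => s j * x + c j := fun j => funext (hsc j)
  set lo : Fin J → ℝ := fun j => min (φ j a) (φ j b) with hlo
  set hi : Fin J → ℝ := fun j => max (φ j a) (φ j b) with hhi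
  have hIcc : ∀ j, φ j '' Set.Icc a b = Set.Icc (lo j) (hi j) := fun j => by
    rw [hlo, hhi]
    simp only [hφe]
    exact image_affine_Icc_min_max (hs0 j) hab.le
  have hIoo : ∀ j, φ j '' Set.Ioo a b = Set.Ioo (lo j) (hi j) := fun j => by
    rw [hlo, hhi]
    simp only [hφe]
    exact image_affine_Ioo_min_max (hs0 j) hab.le
  have hloF : ∀ j, lo j ∈ φ j '' F := fun j => by
    rcases min_choice (φ j a) (φ j b) with h | h
    · exact ⟨a, haF, h.symm⟩
    · exact ⟨b, hbF, h.symm⟩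
  have hhiF : ∀ j, hi j ∈ φ j '' F := fun j => by
    rcases max_choice (φ j a) (φ j b) with h | h
    · exact ⟨a, haF, h.symm⟩
    · exact ⟨b, hbF, h.symm⟩
  have hφF : ∀ j, φ j '' F ⊆ F := fun j => by
    conv_rhs => rw [hFeq]
    exact Set.subset_iUnion (fun j => φ j '' F) j
  have hlt : ∀ j, lo j < hi j := fun j =>
    Set.nonempty_Ioo.1 (hIoo j ▸ (Set.nonempty_Ioo.2 hab).image _)
  have hFI : ∀ j, φ j '' F ⊆ Set.Icc (lo j) (hi j) := fun j => hIcc j ▸ Set.image_mono hFab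
  have hle : ∀ j, a ≤ lo j := fun j => (hFab (hφF j (hloF j))).1
  have hge : ∀ j, hi j ≤ b := fun j => (hFab (hφF j (hhiF j))).2
  have hpack : IsIntervalPacking a b lo hi := by
    refine ⟨hlt, hle, hge, ?_, ?_, ?_⟩
    · intro i j hij
      have := hTSC.disjoint_image i j hij
      rw [hIoo, hIoo, Set.Ioo_disjoint_Ioo, min_le_iff, le_max_iff, le_max_iff] at this
      rcases this with (h | h) | (h | h)
      · exact absurd h (not_le.2 (hlt i))
      · exact Or.inl h
      · exact Or.inr h
      · exact absurd h (not_le.2 (hlt j))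
    · have := haF
      rw [hFeq] at this
      obtain ⟨j, hj⟩ := Set.mem_iUnion.1 this
      exact ⟨j, le_antisymm (hFI j hj).1 (hle j)⟩
    · have := hbF
      rw [hFeq] at this
      obtain ⟨j, hj⟩ := Set.mem_iUnion.1 this
      exact ⟨j, le_antisymm (hge j) (hFI j hj).2⟩
  have hT : initialTile φ F = Set.Icc a b \ ⋃ j, Set.Icc (lo j) (hi j) := by
    rw [initialTile, hC]
    simp_rw [hIcc]
  have hne : (Set.Icc a b \ ⋃ j, Set.Icc (lo j) (hi j)).Nonempty := by
    obtain ⟨w, hw, hw'⟩ := Set.not_subset.1 hNTC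
    simp_rw [hIcc] at hw'
    exact ⟨w, Set.Ioo_subset_Icc_self hw, hw'⟩
  obtain ⟨Q, x, y, hQ0, hQJ, hxy, hx, hy, hinj, hrange, hU, hdisj⟩ := hpack.exists_enumeration hne
  have hvol : ∀ j, hi j - lo j = r j * (b - a) := fun j => by
    have := volume_real_image_affine (s j) (c j) (Set.Icc a b)
    rw [← hφe, hIcc, Real.volume_real_Icc_of_le (hlt j).le, Real.volume_real_Icc_of_le hab.le,
      hsr] at this
    exact this
  have hFG : ∀ q, Disjoint F (Set.Ioo (x q) (y q)) := fun q => by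
    rw [Set.disjoint_left]
    intro f hf hfG
    have hfT : f ∈ Set.Icc a b \ ⋃ j, Set.Icc (lo j) (hi j) := hU ▸ Set.mem_iUnion.2 ⟨q, hfG⟩
    rw [hFeq] at hf
    obtain ⟨j, hj⟩ := Set.mem_iUnion.1 hf
    exact hfT.2 (Set.mem_iUnion.2 ⟨j, hFI j hj⟩)
  have hxF : ∀ q, x q ∈ F := fun q => by
    obtain ⟨j, hj⟩ := hx q
    exact hj ▸ hφF j (hhiF j)
  have hyF : ∀ q, y q ∈ F := fun q => by
    obtain ⟨j, hj⟩ := hy q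
    exact hj ▸ hφF j (hloF j)
  refine ⟨Q, x, y, fun ε => volume.real (Metric.cthickening ε F ∩ Set.Icc a b), b - a, hQ0, hQJ,
    hxy, hinj, ?_, ?_, fun ε hε => tubeVolume_eq_add hFc hFne hε.le, ?_,
    fun ε => measureReal_nonneg, ?_, ?_⟩
  · rw [hrange, generators, hT]
  -- Total length: `(∑ j, r j) * (b - a)` plus the positive length of the gaps equals `b - a`.
  · have h1 := hpack.volume_real_inter_Icc hU hdisj MeasurableSet.univ
    simp only [Set.univ_inter, Real.volume_real_Icc_of_le hab.le,
      Real.volume_real_Icc_of_le (hlt _).le, Real.volume_real_Ioo_of_le (hxy _).le, hvol] at h1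
    rw [← Finset.sum_mul] at h1
    have h2 : 0 < ∑ q, (y q - x q) :=
      Finset.sum_pos (fun q _ => sub_pos.2 (hxy q)) ⟨⟨0, hQ0⟩, Finset.mem_univ _⟩
    have h3 : 0 < b - a := sub_pos.2 hab
    by_contra! h4
    nlinarith
  · intro ε ε' h
    exact measureReal_mono (Set.inter_subset_inter_left _ (Metric.cthickening_mono h F))
      (measure_ne_top_of_subset Set.inter_subset_right (by simp))
  · intro ε
    rw [← Real.volume_real_Icc_of_le hab.le]
    exact measureReal_mono Set.inter_subset_right (by simp)
  · intro ε hε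
    beta_reduce
    rw [hpack.volume_real_inter_Icc hU hdisj Metric.isClosed_cthickening.measurableSet]
    congr 1
    · refine Finset.sum_congr rfl fun j _ => ?_
      rw [cthickening_inter_image_eq hFc (hφ.ratio_pos j) (hφ.dist_map j) hε.le (hIcc j) (hloF j)
        (hhiF j) (hφF j), hφe j, volume_real_image_affine, hsr]
      intro w hw
      rw [hFeq] at hw
      obtain ⟨k, hk⟩ := Set.mem_iUnion.1 hw
      rcases eq_or_ne k j with rfl | hkj
      · exact Or.inl hk
      · right
        have := hFI k hk
        rcases hpack.separated k j hkj with h | h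
        · exact Or.inl (this.2.trans h)
        · exact Or.inr (h.trans this.1)
    · exact Finset.sum_congr rfl fun q _ =>
        volume_real_cthickening_inter_Ioo hFc (hxy q) hε.le (hxF q) (hyF q) (hFG q)

/-! ### Zeta functions and residues -/

theorem Complex.ofReal_prod_cpow {ι : Type*} (S : Finset ι) {f : ι → ℝ} (hf : ∀ i ∈ S, 0 ≤ f i)
    (s : ℂ) : ((∏ i ∈ S, f i : ℝ) : ℂ) ^ s = ∏ i ∈ S, (f i : ℂ) ^ s := by
  classical
  induction S using Finset.induction_on with
  | empty => simp
  | insert a S ha ih =>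
    rw [Finset.prod_insert ha, Finset.prod_insert ha, Complex.ofReal_mul,
      Complex.mul_cpow_ofReal_nonneg (hf a (Finset.mem_insert_self _ _))
        (Finset.prod_nonneg fun i hi => hf i (Finset.mem_insert_of_mem hi)),
      ih fun i hi => hf i (Finset.mem_insert_of_mem hi)]

section

variable {J : ℕ} {r : Fin J → ℝ}

theorem hasDerivAt_one_sub_sum_cpow (hr : ∀ j, 0 < r j) (s : ℂ) :
    HasDerivAt (fun s : ℂ => 1 - ∑ j, (r j : ℂ) ^ s)
      (-∑ j, (r j : ℂ) ^ s * Complex.log (r j)) s := by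
  refine HasDerivAt.const_sub 1 (HasDerivAt.fun_sum fun j _ => ?_)
  have := (hasDerivAt_id s).const_cpow (c := (r j : ℂ))
    (Or.inl (by exact_mod_cast (hr j).ne'))
  simpa using this

theorem differentiable_one_sub_sum_cpow (hr : ∀ j, 0 < r j) :
    Differentiable ℂ fun s : ℂ => 1 - ∑ j, (r j : ℂ) ^ s := fun s =>
  (hasDerivAt_one_sub_sum_cpow hr s).differentiableAt

/-- The sum over words of length n is the n-th power of `∑ j, r j ^ s`, so the series is geometric;
its ratio has norm less than `∑ j, r j ^ D = 1` when `Re s > D`. -/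
theorem isScalingZetaExtension_scalingZeta (hr : ∀ j, 0 < r j) (hr1 : ∀ j, r j < 1) {D : ℝ}
    (hD : ∑ j, r j ^ D = 1) : IsScalingZetaExtension r D (scalingZeta r) where
  hasSum s hs := by
    have hne : (Finset.univ : Finset (Fin J)).Nonempty := by
      by_contra h
      rw [Finset.not_nonempty_iff_eq_empty] at h
      simp [h] at hD
    have hnorm : ‖∑ j, (r j : ℂ) ^ s‖ < 1 := by
      refine (norm_sum_le _ _).trans_lt ?_
      rw [← hD]
      refine Finset.sum_lt_sum_of_nonempty hne fun j _ => ?_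
      rw [Complex.norm_cpow_eq_rpow_re_of_pos (hr j)]
      exact Real.rpow_lt_rpow_of_exponent_gt (hr j) (hr1 j) hs
    have := hasSum_geometric_of_norm_lt_one hnorm
    rw [scalingZeta, one_div]
    refine this.congr_fun fun n => ?_
    rw [Fintype.sum_pow]
    exact Finset.sum_congr rfl fun w _ => Complex.ofReal_prod_cpow _ (fun i _ => (hr _).le) s
  meromorphicAt s := by
    have := (differentiable_one_sub_sum_cpow hr).analyticAt s
    exact (MeromorphicAt.const 1 s).div this.meromorphicAt

end

/-- The residue of a quotient at a simple zero of the denominator. -/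
theorem hasResidueAt_of_eventuallyEq_div {f g h : ℂ → ℂ} {z d : ℂ}
    (hf : f =ᶠ[𝓝 z] fun s => g s / h s) (hg : AnalyticAt ℂ g z) (hh : Differentiable ℂ h)
    (hz : h z = 0) (hd : HasDerivAt h d z) (hd0 : d ≠ 0) : HasResidueAt f z (g z / d) := by
  -- `dslope h z` is `h` with its zero at `z` divided out, so `f` is `(s - z)⁻¹` times an analytic
  -- function and Cauchy's formula applies on small circles.
  have hkd : Differentiable ℂ (dslope h z) := by
    rw [← differentiableOn_univ, Complex.differentiableOn_dslope univ_mem]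
    exact hh.differentiableOn
  have hkz : dslope h z z = d := by rw [dslope_same, hd.deriv]
  have hka := hkd.analyticAt z
  have hF : AnalyticAt ℂ (fun s => g s / dslope h z s) z := hg.div hka (by rwa [hkz])
  refine ⟨(hg.meromorphicAt.div (hh.analyticAt z).meromorphicAt).congr
    (hf.symm.filter_mono nhdsWithin_le_nhds), ?_⟩
  obtain ⟨R, hR, hball⟩ := Metric.eventually_nhds_iff_ball.1 (hf.and hF.eventually_analyticAt)
  filter_upwards [Ioo_mem_nhdsGT hR] with ρ hρ
  have hsub : Metric.closedBall z ρ ⊆ Metric.ball z R := Metric.closedBall_subset_ball hρ.2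
  have h1 : (∮ w in C(z, ρ), f w) =
      ∮ w in C(z, ρ), (w - z)⁻¹ • (g w / dslope h z w) := by
    refine circleIntegral.integral_congr hρ.1.le fun w hw => ?_
    have hwz : w ≠ z := by
      rintro rfl
      simp at hw
      linarith [hρ.1]
    have h2 := (hball w (hsub (Metric.sphere_subset_closedBall hw))).1
    rw [h2, dslope_of_ne _ hwz, slope_def_field, hz, sub_zero]
    have : w - z ≠ 0 := sub_ne_zero.2 hwz
    rw [smul_eq_mul]
    field_simp
  have h3 : DiffContOnCl ℂ (fun s => g s / dslope h z s) (Metric.ball z ρ) := by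
    refine DifferentiableOn.diffContOnCl fun w hw => ?_
    rw [closure_ball z hρ.1.ne'] at hw
    exact (hball w (hsub hw)).2.differentiableAt.differentiableWithinAt
  have h4 := h3.circleIntegral_sub_inv_smul (Metric.mem_ball_self hρ.1)
  rw [h1, h4, hkz, smul_eq_mul, ← mul_assoc, inv_mul_cancel₀, one_mul]
  exact Complex.two_pi_I_ne_zero

theorem hasResidueAt_gapContent {J Q : ℕ} {r : Fin J → ℝ} (hr : ∀ j, 0 < r j)
    (hr1 : ∀ j, r j < 1) {D : ℝ} (hD0 : 0 < D) (hD1 : D < 1) (hD : ∑ j, r j ^ D = 1)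
    {l : Fin Q → ℝ} (hl : ∀ q, 0 < l q) :
    HasResidueAt (fun s => scalingZeta r s * (2 ^ (1 - s) / (s * (1 - s))) * ∑ q, (l q : ℂ) ^ s)
      (D : ℂ) (gapContent r l D : ℂ) := by
  have hne : (Finset.univ : Finset (Fin J)).Nonempty := by
    by_contra h
    rw [Finset.not_nonempty_iff_eq_empty] at h
    simp [h] at hD
  have hpow : ∀ {a : ℝ}, 0 < a → (a : ℂ) ^ (D : ℂ) = ((a ^ D : ℝ) : ℂ) := fun ha =>
    (Complex.ofReal_cpow ha.le D).symm
  have hder := hasDerivAt_one_sub_sum_cpow hr (D : ℂ)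
  have hm : 0 < ∑ j, r j ^ D * Real.log (r j)⁻¹ :=
    Finset.sum_pos (fun j _ => mul_pos (Real.rpow_pos_of_pos (hr j) D)
      (Real.log_pos ((one_lt_inv₀ (hr j)).2 (hr1 j)))) hne
  have hmc : -∑ j, (r j : ℂ) ^ (D : ℂ) * Complex.log (r j) =
      ((∑ j, r j ^ D * Real.log (r j)⁻¹ : ℝ) : ℂ) := by
    rw [← Finset.sum_neg_distrib, Complex.ofReal_sum]
    refine Finset.sum_congr rfl fun j _ => ?_
    rw [hpow (hr j), ← Complex.ofReal_log (hr j).le, Real.log_inv]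
    push_cast
    ring
  rw [hmc] at hder
  have hz : (1 : ℂ) - ∑ j, (r j : ℂ) ^ (D : ℂ) = 0 := by
    simp_rw [hpow (hr _)]
    rw [← Complex.ofReal_sum, hD]
    simp
  have hDc0 : (D : ℂ) ≠ 0 := by exact_mod_cast hD0.ne'
  have hDc1 : (1 : ℂ) - D ≠ 0 := by
    rw [sub_ne_zero]; exact_mod_cast hD1.ne'
  have hg : AnalyticAt ℂ (fun s : ℂ => (2 ^ (1 - s) / (s * (1 - s))) * ∑ q, (l q : ℂ) ^ s) D := by
    have h1 : AnalyticAt ℂ (fun s : ℂ => (2 : ℂ) ^ (1 - s)) D := by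
      refine Differentiable.analyticAt (fun s => ?_) _
      exact ((differentiableAt_id.const_sub 1).const_cpow (Or.inl two_ne_zero))
    have h2 : AnalyticAt ℂ (fun s : ℂ => ∑ q, (l q : ℂ) ^ s) D := by
      refine Differentiable.analyticAt (fun s => ?_) _
      exact DifferentiableAt.fun_sum fun q _ =>
        differentiableAt_id.const_cpow (Or.inl (by exact_mod_cast (hl q).ne'))
    have h3 : AnalyticAt ℂ (fun s : ℂ => s * (1 - s)) D := by fun_prop
    exact (h1.div h3 (mul_ne_zero hDc0 hDc1)).mul h2
  have := hasResidueAt_of_eventuallyEq_div (f := fun s => scalingZeta r s *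
    (2 ^ (1 - s) / (s * (1 - s))) * ∑ q, (l q : ℂ) ^ s) (.of_forall fun s => by
      simp only [scalingZeta]
      ring) hg (differentiable_one_sub_sum_cpow hr) hz hder (by exact_mod_cast hm.ne')
  convert this using 1
  rw [gapContent]
  simp_rw [hpow (hl _)]
  have h2 : (2 : ℂ) ^ (1 - (D : ℂ)) = (((2 : ℝ) ^ (1 - D) : ℝ) : ℂ) := by
    rw [Complex.ofReal_cpow (by norm_num)]
    push_cast
    rfl
  rw [h2]
  have hmc0 : ((∑ j, r j ^ D * Real.log (r j)⁻¹ : ℝ) : ℂ) ≠ 0 := by exact_mod_cast hm.ne'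
  push_cast at hmc0 ⊢
  field_simp

/-- With `g = l / 2` both terms are multiples of `2 ^ (1 - s) * l ^ s`, and 1/s - 1/(s - 1) = 1/(s(1
- s)). -/
theorem geometricZeta_Ioo {J : ℕ} (r : Fin J → ℝ) {x y : ℝ} (hxy : x < y) {s : ℂ} (ε : ℝ)
    (hs0 : s ≠ 0) (hs1 : s ≠ 1) :
    geometricZeta r (Set.Ioo x y) (fun m => if m = 0 then 2 else -(y - x)) s ε =
        scalingZeta r s * (ε : ℂ) ^ (1 - s) *
          (2 * (inradius (Set.Ioo x y) : ℂ) ^ s / s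
            - ((y - x : ℝ) : ℂ) * (inradius (Set.Ioo x y) : ℂ) ^ (s - 1) / (s - 1)) ∧
      geometricZeta r (Set.Ioo x y) (fun m => if m = 0 then 2 else -(y - x)) s ε =
        scalingZeta r s * (ε : ℂ) ^ (1 - s) *
          (2 ^ (1 - s) * ((y - x : ℝ) : ℂ) ^ s / (s * (1 - s))) := by
  have h1 : geometricZeta r (Set.Ioo x y) (fun m => if m = 0 then 2 else -(y - x)) s ε =
        scalingZeta r s * (ε : ℂ) ^ (1 - s) *
          (2 * (inradius (Set.Ioo x y) : ℂ) ^ s / s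
            - ((y - x : ℝ) : ℂ) * (inradius (Set.Ioo x y) : ℂ) ^ (s - 1) / (s - 1)) := by
    simp [geometricZeta, Finset.sum_range_succ]
    ring_nf
    tauto
  refine ⟨h1, ?_⟩
  rw [h1, inradius_Ioo hxy]
  congr 1
  have hl : 0 < y - x := sub_pos.2 hxy
  have hlc : ((y - x : ℝ) : ℂ) ≠ 0 := by exact_mod_cast hl.ne'
  set l := y - x with hldef
  have hg : (((l / 2 : ℝ)) : ℂ) ≠ 0 := by exact_mod_cast (half_pos hl).ne'
  have h2 : (((l / 2 : ℝ)) : ℂ) ^ s = (l : ℂ) ^ s / 2 ^ s := by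
    rw [Complex.ofReal_div, Complex.div_cpow_ofReal_nonneg hl.le (by norm_num)]
    simp
  have h3 : (2 : ℂ) ^ s ≠ 0 := by simp [Complex.cpow_eq_zero_iff]
  have hs1' : s - 1 ≠ 0 := sub_ne_zero.2 hs1
  have hs1'' : 1 - s ≠ 0 := sub_ne_zero.2 hs1.symm
  rw [Complex.cpow_sub _ _ hg, Complex.cpow_sub _ _ two_ne_zero, h2, Complex.cpow_one,
    Complex.cpow_one, Complex.ofReal_div]
  push_cast
  field_simp
  ring

/-- The powers of ε cancel. The closed form needs `s ≠ 0, 1`, which holds near `D` because `0 < D <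
1`. -/
theorem hasResidueAt_sum_geometricZeta {J Q : ℕ} {r : Fin J → ℝ} (hr : ∀ j, 0 < r j)
    (hr1 : ∀ j, r j < 1) {D : ℝ} (hD0 : 0 < D) (hD1 : D < 1) (hD : ∑ j, r j ^ D = 1)
    {x y : Fin Q → ℝ} (hxy : ∀ q, x q < y q) {ε : ℝ} (hε : 0 < ε) :
    HasResidueAt (fun s => (∑ q, geometricZeta r (Set.Ioo (x q) (y q))
        (fun m => if m = 0 then 2 else -(y q - x q)) s ε) * (ε : ℂ) ^ (s - 1))
      (D : ℂ) (gapContent r (fun q => y q - x q) D : ℂ) := by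
  obtain ⟨h1, h2⟩ := hasResidueAt_gapContent hr hr1 hD0 hD1 hD fun q => sub_pos.2 (hxy q)
  have hεc : (ε : ℂ) ≠ 0 := by exact_mod_cast hε.ne'
  have heq : ∀ s : ℂ, s ≠ 0 → s ≠ 1 →
      scalingZeta r s * (2 ^ (1 - s) / (s * (1 - s))) * ∑ q, ((y q - x q : ℝ) : ℂ) ^ s =
      (∑ q, geometricZeta r (Set.Ioo (x q) (y q))
        (fun m => if m = 0 then 2 else -(y q - x q)) s ε) * (ε : ℂ) ^ (s - 1) := by
    intro s hs0 hs1
    have : (ε : ℂ) ^ (1 - s) * (ε : ℂ) ^ (s - 1) = 1 := by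
      rw [← Complex.cpow_add _ _ hεc]
      simp
    simp_rw [fun q => (geometricZeta_Ioo r (hxy q) ε hs0 hs1).2]
    rw [Finset.mul_sum, Finset.sum_mul]
    refine Finset.sum_congr rfl fun q _ => ?_
    linear_combination (-(scalingZeta r s * (2 ^ (1 - s) * ((y q - x q : ℝ) : ℂ) ^ s /
      (s * (1 - s))))) * this
  have hnear : ∀ᶠ s in 𝓝 (D : ℂ), s ≠ 0 ∧ s ≠ 1 :=
    (eventually_ne_nhds (by exact_mod_cast hD0.ne')).and
      (eventually_ne_nhds (by exact_mod_cast hD1.ne))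
  refine ⟨h1.congr (eventually_nhdsWithin_of_eventually_nhds (hnear.mono fun s hs =>
    heq s hs.1 hs.2)), ?_⟩
  obtain ⟨R, hR, hball⟩ := Metric.eventually_nhds_iff_ball.1 hnear
  filter_upwards [h2, Ioo_mem_nhdsGT hR] with ρ h hρ
  rw [← h]
  congr 1
  refine circleIntegral.integral_congr hρ.1.le fun w hw => ?_
  have := hball w (Metric.closedBall_subset_ball hρ.2 (Metric.sphere_subset_closedBall hw))
  exact (heq w this.1 this.2).symm

/-! ### The tube function as a solution of a renewal equation -/

/-- The functional equation of the tube function inside the convex hull. -/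
structure IsTubeFunction {J Q : ℕ} (r : Fin J → ℝ) (D : ℝ) (l : Fin Q → ℝ) (v : ℝ → ℝ) (L : ℝ) :
    Prop where
  two_le : 2 ≤ J
  gaps_pos : 0 < Q
  ratio_pos : ∀ j, 0 < r j
  ratio_lt_one : ∀ j, r j < 1
  dim_pos : 0 < D
  dim_lt_one : D < 1
  sum_rpow : ∑ j, r j ^ D = 1
  gap_pos : ∀ q, 0 < l q
  mono : Monotone v
  nonneg : ∀ ε, 0 ≤ v ε
  le : ∀ ε, v ε ≤ L
  eq : ∀ ε > 0, v ε = ∑ j, r j * v (ε / r j) + ∑ q, min (2 * ε) (l q)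

/-- The tube function in the logarithmic scale, normalized to dimension `D`. -/
def logTube (D : ℝ) (v : ℝ → ℝ) (t : ℝ) : ℝ := Real.exp ((1 - D) * t) * v (Real.exp (-t))

/-- The contribution of the gaps of lengths `l q` in the logarithmic scale. -/
def logGaps {Q : ℕ} (D : ℝ) (l : Fin Q → ℝ) (t : ℝ) : ℝ :=
  Real.exp ((1 - D) * t) * ∑ q, min (2 * Real.exp (-t)) (l q)

/-- At `t = log (2 / l)` the two collars of the gap meet: before that time the gap is filled,
afterwards it is not. -/
theorem logGap_eq_of_le {D l t : ℝ} (hl : 0 < l) (ht : t ≤ Real.log (2 / l)) :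
    Real.exp ((1 - D) * t) * min (2 * Real.exp (-t)) l = Real.exp ((1 - D) * t) * l := by
  have h := (Real.le_log_iff_exp_le (by positivity)).1 ht
  rw [le_div_iff₀ hl] at h
  rw [min_eq_right]
  rw [Real.exp_neg, ← div_eq_mul_inv, le_div_iff₀ (Real.exp_pos t)]
  linarith

theorem logGap_eq_of_ge {D l t : ℝ} (hl : 0 < l) (ht : Real.log (2 / l) ≤ t) :
    Real.exp ((1 - D) * t) * min (2 * Real.exp (-t)) l = 2 * Real.exp (-D * t) := by
  have h := (Real.log_le_iff_le_exp (by positivity)).1 ht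
  rw [div_le_iff₀ hl] at h
  rw [min_eq_left]
  · rw [show -D * t = (1 - D) * t + -t by ring, Real.exp_add]
    ring
  · rw [Real.exp_neg, ← div_eq_mul_inv, div_le_iff₀ (Real.exp_pos t)]
    linarith

theorem integrable_logGap {D l : ℝ} (hD0 : 0 < D) (hD1 : D < 1) (hl : 0 < l) :
    Integrable fun t => Real.exp ((1 - D) * t) * min (2 * Real.exp (-t)) l := by
  rw [← integrableOn_univ, ← Set.Iic_union_Ioi (a := Real.log (2 / l)), integrableOn_union]
  constructor
  · exact IntegrableOn.congr_fun ((integrableOn_exp_mul_Iic (sub_pos.2 hD1) _).mul_const l)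
      (fun t ht => (logGap_eq_of_le hl ht).symm) measurableSet_Iic
  · exact IntegrableOn.congr_fun ((integrableOn_exp_mul_Ioi (neg_lt_zero.2 hD0) _).const_mul 2)
      (fun t ht => (logGap_eq_of_ge hl (le_of_lt ht)).symm) measurableSet_Ioi

/-- The two exponential tails contribute `2 ^ (1 - D) * l ^ D` times 1/(1 - D) and 1/D, mirroring
the two terms of the geometric zeta function. -/
theorem integral_logGap {D l : ℝ} (hD0 : 0 < D) (hD1 : D < 1) (hl : 0 < l) :
    ∫ t, Real.exp ((1 - D) * t) * min (2 * Real.exp (-t)) l =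
      2 ^ (1 - D) * l ^ D / (D * (1 - D)) := by
  have h1D := sub_pos.2 hD1
  have hint := integrable_logGap hD0 hD1 hl
  rw [← intervalIntegral.integral_Iic_add_Ioi (b := Real.log (2 / l)) hint.integrableOn
    hint.integrableOn, setIntegral_congr_fun measurableSet_Iic fun t ht => logGap_eq_of_le hl ht,
    setIntegral_congr_fun measurableSet_Ioi fun t ht => logGap_eq_of_ge hl (le_of_lt ht),
    integral_mul_const, integral_const_mul, integral_exp_mul_Iic h1D,
    integral_exp_mul_Ioi (neg_lt_zero.2 hD0)]
  have h2l : 0 < 2 / l := by positivity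
  have e1 : Real.exp ((1 - D) * Real.log (2 / l)) = 2 ^ (1 - D) * l ^ D / l := by
    rw [mul_comm, ← Real.rpow_def_of_pos h2l, Real.div_rpow (by norm_num) hl.le,
      Real.rpow_sub hl 1 D, Real.rpow_one]
    field_simp
  have e2 : Real.exp (-D * Real.log (2 / l)) = 2 ^ (1 - D) * l ^ D / 2 := by
    rw [mul_comm, ← Real.rpow_def_of_pos h2l, Real.rpow_neg h2l.le,
      Real.div_rpow (by norm_num) hl.le, Real.rpow_sub (by norm_num) 1 D, Real.rpow_one]
    field_simp
  rw [e1, e2]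
  field_simp
  ring

theorem logGaps_eq_sum {Q : ℕ} (D : ℝ) (l : Fin Q → ℝ) :
    logGaps D l = fun t => ∑ q, Real.exp ((1 - D) * t) * min (2 * Real.exp (-t)) (l q) := by
  funext t
  rw [logGaps, Finset.mul_sum]

theorem logGaps_le {Q : ℕ} (D : ℝ) (l : Fin Q → ℝ) (t : ℝ) :
    logGaps D l t ≤ 2 * Q * Real.exp (-(D * t)) := by
  have h : ∑ q, min (2 * Real.exp (-t)) (l q) ≤ ∑ _q : Fin Q, 2 * Real.exp (-t) :=
    Finset.sum_le_sum fun q _ => min_le_left _ _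
  rw [Finset.sum_const, Finset.card_univ, Fintype.card_fin, nsmul_eq_mul] at h
  calc logGaps D l t ≤ Real.exp ((1 - D) * t) * (Q * (2 * Real.exp (-t))) :=
        mul_le_mul_of_nonneg_left h (Real.exp_pos _).le
    _ = 2 * Q * Real.exp (-(D * t)) := by
        rw [show -(D * t) = (1 - D) * t + -t by ring, Real.exp_add]; ring

theorem logGaps_nonneg {Q : ℕ} (D : ℝ) {l : Fin Q → ℝ} (hl : ∀ q, 0 < l q) (t : ℝ) :
    0 ≤ logGaps D l t :=
  mul_nonneg (Real.exp_pos _).le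
    (Finset.sum_nonneg fun q _ => le_min (by positivity) (hl q).le)

/-- Induction along steps bounded below. -/
theorem forall_ge_of_forall_step {P : ℝ → Prop} {a T m : ℝ} (hm : 0 < m)
    (h0 : ∀ t, a - T ≤ t → t ≤ a → P t)
    (h1 : ∀ t, a < t → (∀ s, a - T ≤ s → s ≤ t - m → P s) → P t) :
    ∀ t, a - T ≤ t → P t := by
  have key : ∀ n : ℕ, ∀ t, a - T ≤ t → t ≤ a + n * m → P t := by
    intro n
    induction n with
    | zero => intro t ht ht'; exact h0 t ht (by simpa using ht')
    | succ n ih =>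
      intro t ht ht'
      by_cases hta : t ≤ a
      · exact h0 t ht hta
      · refine h1 t (not_le.1 hta) fun s hs hs' => ih s hs ?_
        push_cast at ht'
        linarith
  intro t ht
  obtain ⟨n, hn⟩ := exists_nat_ge ((t - a) / m)
  exact key n t ht (by linarith [(div_le_iff₀ hm).1 hn])

namespace IsTubeFunction

variable {J Q : ℕ} {r : Fin J → ℝ} {D : ℝ} {l : Fin Q → ℝ} {v : ℝ → ℝ} {L : ℝ}

theorem step_pos (h : IsTubeFunction r D l v L) (j : Fin J) : 0 < Real.log (r j)⁻¹ :=
  Real.log_pos ((one_lt_inv₀ (h.ratio_pos j)).2 (h.ratio_lt_one j))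

/-- Dilation by `(r j)⁻¹` becomes a shift by `log (r j)⁻¹`, and the normalization `exp ((1 - D) *
t)` turns the factor `r j` into `r j ^ D`. -/
theorem logTube_eq (h : IsTubeFunction r D l v L) (t : ℝ) :
    logTube D v t = ∑ j, r j ^ D * logTube D v (t - Real.log (r j)⁻¹) + logGaps D l t := by
  rw [logTube, h.eq _ (Real.exp_pos _), mul_add, logGaps, Finset.mul_sum]
  congr 1
  refine Finset.sum_congr rfl fun j _ => ?_
  have hr := h.ratio_pos j
  rw [logTube, Real.log_inv, sub_neg_eq_add, neg_add, Real.exp_add (-t), Real.exp_neg (Real.log _),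
    Real.exp_log hr, ← div_eq_mul_inv, mul_add, Real.exp_add, mul_comm (1 - D) (Real.log _),
    ← Real.rpow_def_of_pos hr, Real.rpow_sub hr, Real.rpow_one]
  have := (Real.rpow_pos_of_pos hr D).ne'
  field_simp

theorem logTube_nonneg (h : IsTubeFunction r D l v L) (t : ℝ) : 0 ≤ logTube D v t :=
  mul_nonneg (Real.exp_pos _).le (h.nonneg _)

theorem logTube_le (h : IsTubeFunction r D l v L) (t : ℝ) :
    logTube D v t ≤ Real.exp ((1 - D) * t) * L :=
  mul_le_mul_of_nonneg_left (h.le _) (Real.exp_pos _).le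

theorem measurable_logTube (h : IsTubeFunction r D l v L) : Measurable (logTube D v) := by
  have : Measurable fun t : ℝ => v (Real.exp (-t)) := h.mono.measurable.comp (by fun_prop)
  exact Measurable.mul (by fun_prop) this

theorem tendsto_logGaps (h : IsTubeFunction r D l v L) : Tendsto (logGaps D l) atTop (𝓝 0) := by
  refine squeeze_zero (logGaps_nonneg D h.gap_pos) (logGaps_le D l) ?_
  have : Tendsto (fun t => Real.exp (-(D * t))) atTop (𝓝 0) :=
    Real.tendsto_exp_neg_atTop_nhds_zero.comp (tendsto_id.const_mul_atTop h.dim_pos)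
  simpa using this.const_mul (2 * (Q : ℝ))

theorem isRenewalSolution (h : IsTubeFunction r D l v L) :
    IsRenewalSolution (fun j => r j ^ D) (fun j => Real.log (r j)⁻¹) (logTube D v)
      (logGaps D l) where
  weight_pos j := Real.rpow_pos_of_pos (h.ratio_pos j) D
  weight_sum := h.sum_rpow
  step_pos := h.step_pos
  eq := h.logTube_eq
  integrableOn t := by
    refine Integrable.mono' ((integrableOn_exp_mul_Iic (sub_pos.2 h.dim_lt_one) t).mul_const L)
      h.measurable_logTube.aestronglyMeasurable (.of_forall fun s => ?_)
    rw [Real.norm_of_nonneg (h.logTube_nonneg s)]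
    exact h.logTube_le s
  integrable := by
    rw [logGaps_eq_sum]
    exact integrable_finsetSum _ fun q _ =>
      integrable_logGap h.dim_pos h.dim_lt_one (h.gap_pos q)
  tendsto_zero := h.tendsto_logGaps

theorem integral_logGaps_div (h : IsTubeFunction r D l v L) :
    (∫ t, logGaps D l t) / ∑ j, r j ^ D * Real.log (r j)⁻¹ = gapContent r l D := by
  rw [logGaps_eq_sum, integral_finsetSum _ fun q _ =>
    integrable_logGap h.dim_pos h.dim_lt_one (h.gap_pos q)]
  simp_rw [fun q => integral_logGap h.dim_pos h.dim_lt_one (h.gap_pos q)]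
  rw [gapContent, ← Finset.sum_div, ← Finset.mul_sum, div_div]

/-- Monotonicity of `v` supplies the one-sided regularity that the renewal theorem uses in place of
continuity. -/
theorem logTube_add_le (h : IsTubeFunction r D l v L) (t δ : ℝ) (hδ : 0 ≤ δ) :
    logTube D v (t + δ) ≤ Real.exp ((1 - D) * δ) * logTube D v t := by
  have : v (Real.exp (-(t + δ))) ≤ v (Real.exp (-t)) :=
    h.mono (Real.exp_le_exp.2 (by linarith))
  calc logTube D v (t + δ) ≤ Real.exp ((1 - D) * (t + δ)) * v (Real.exp (-t)) :=
        mul_le_mul_of_nonneg_left this (Real.exp_pos _).le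
    _ = _ := by rw [logTube, mul_add, Real.exp_add]; ring

theorem exists_step_bounds (h : IsTubeFunction r D l v L) :
    ∃ m T : ℝ, 0 < m ∧ 0 < T ∧ ∀ j, m ≤ Real.log (r j)⁻¹ ∧ Real.log (r j)⁻¹ ≤ T := by
  have hne : (Finset.univ : Finset (Fin J)).Nonempty := ⟨⟨0, by have := h.two_le; omega⟩, by simp⟩
  obtain ⟨i, -, hi⟩ := Finset.exists_min_image _ (fun j => Real.log (r j)⁻¹) hne
  obtain ⟨k, -, hk⟩ := Finset.exists_max_image _ (fun j => Real.log (r j)⁻¹) hne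
  exact ⟨_, _, h.step_pos i, h.step_pos k, fun j =>
    ⟨hi j (Finset.mem_univ _), hk j (Finset.mem_univ _)⟩⟩

theorem exists_logTube_le (h : IsTubeFunction r D l v L) : ∃ B, ∀ t, logTube D v t ≤ B := by
  obtain ⟨m, T, hm, hT, hmT⟩ := h.exists_step_bounds
  set B : ℝ := 2 * Q with hB
  have hB0 : 0 ≤ B := by positivity
  have hD := h.dim_pos
  have hL0 : 0 ≤ L := (h.nonneg 0).trans (h.le 0)
  have hneg : ∀ t ≤ 0, logTube D v t ≤ L := fun t ht => by
    refine (h.logTube_le t).trans ?_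
    have : Real.exp ((1 - D) * t) ≤ 1 :=
      Real.exp_le_one_iff.2 (mul_nonpos_of_nonneg_of_nonpos (sub_pos.2 h.dim_lt_one).le ht)
    nlinarith
  -- `A - B * exp (-(D * t))` is a supersolution: the shifts turn its decaying part into `J` copies
  -- of `B * exp (-(D * t))`; as `J ≥ 2`, one copy absorbs the gap term and another restores the
  -- bound. The constant `A` makes the bound true on `[-T, 0]`.
  set A := L + B * Real.exp (D * T) with hA
  have key : ∀ t, 0 - T ≤ t → logTube D v t ≤ A - B * Real.exp (-(D * t)) := by
    refine forall_ge_of_forall_step hm (fun t ht ht0 => ?_) fun t ht ih => ?_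
    · have : Real.exp (-(D * t)) ≤ Real.exp (D * T) := Real.exp_le_exp.2 (by nlinarith)
      have := hneg t ht0
      nlinarith
    · rw [h.logTube_eq]
      have h1 : ∀ j, r j ^ D * logTube D v (t - Real.log (r j)⁻¹) ≤
          r j ^ D * A - B * Real.exp (-(D * t)) := by
        intro j
        have hrD := Real.rpow_pos_of_pos (h.ratio_pos j) D
        have := mul_le_mul_of_nonneg_left
          (ih (t - Real.log (r j)⁻¹) (by linarith [(hmT j).2]) (by linarith [(hmT j).1])) hrD.le
        refine this.trans (le_of_eq ?_)
        have e : r j ^ D * Real.exp (-(D * (t - Real.log (r j)⁻¹))) = Real.exp (-(D * t)) := by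
          rw [Real.rpow_def_of_pos (h.ratio_pos j), ← Real.exp_add, Real.log_inv]
          congr 1; ring
        rw [mul_sub, mul_left_comm, e]
      have h2 := Finset.sum_le_sum fun j (_ : j ∈ Finset.univ) => h1 j
      rw [Finset.sum_sub_distrib, ← Finset.sum_mul, h.sum_rpow, one_mul, Finset.sum_const,
        Finset.card_univ, Fintype.card_fin, nsmul_eq_mul] at h2
      have h3 := logGaps_le D l t
      have h4 : (2 : ℝ) ≤ J := by exact_mod_cast h.two_le
      have h5 : 0 ≤ B * Real.exp (-(D * t)) := by positivity
      nlinarith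
  refine ⟨A, fun t => ?_⟩
  by_cases ht : 0 - T ≤ t
  · refine (key t ht).trans ?_
    have : 0 ≤ B * Real.exp (-(D * t)) := by positivity
    linarith
  · refine (hneg t (by linarith)).trans ?_
    have : 0 ≤ B * Real.exp (D * T) := by positivity
    linarith

theorem pos (h : IsTubeFunction r D l v L) {ε : ℝ} (hε : 0 < ε) : 0 < v ε := by
  rw [h.eq ε hε]
  refine add_pos_of_nonneg_of_pos
    (Finset.sum_nonneg fun j _ => mul_nonneg (h.ratio_pos j).le (h.nonneg _)) ?_
  exact Finset.sum_pos (fun q _ => lt_min (by positivity) (h.gap_pos q))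
    ⟨⟨0, h.gaps_pos⟩, Finset.mem_univ _⟩

/-- Constants are subsolutions because the weights sum to one and the gap term is nonnegative, so a
lower bound on one window of length `T` persists. -/
theorem exists_le_logTube (h : IsTubeFunction r D l v L) :
    ∃ c > 0, ∀ t ≥ 0, c ≤ logTube D v t := by
  obtain ⟨m, T, hm, hT, hmT⟩ := h.exists_step_bounds
  refine ⟨v (Real.exp (-T)), h.pos (Real.exp_pos _), fun t ht => ?_⟩
  refine forall_ge_of_forall_step (a := T) (T := T)
    (P := fun t => v (Real.exp (-T)) ≤ logTube D v t) hm (fun t ht ht' => ?_)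
    (fun t ht ih => ?_) t (by linarith)
  · have h1 : v (Real.exp (-T)) ≤ v (Real.exp (-t)) := h.mono (Real.exp_le_exp.2 (by linarith))
    have h2 : 1 ≤ Real.exp ((1 - D) * t) :=
      Real.one_le_exp (mul_nonneg (sub_pos.2 h.dim_lt_one).le (by linarith))
    have := h.nonneg (Real.exp (-t))
    rw [logTube]
    nlinarith
  · rw [h.logTube_eq]
    have h1 : ∑ j, r j ^ D * v (Real.exp (-T)) ≤
        ∑ j, r j ^ D * logTube D v (t - Real.log (r j)⁻¹) :=
      Finset.sum_le_sum fun j _ => mul_le_mul_of_nonneg_left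
        (ih _ (by linarith [(hmT j).2]) (by linarith [(hmT j).1]))
        (Real.rpow_pos_of_pos (h.ratio_pos j) D).le
    rw [← Finset.sum_mul, h.sum_rpow, one_mul] at h1
    linarith [logGaps_nonneg D h.gap_pos t]

theorem tendsto_logTube_atBot (h : IsTubeFunction r D l v L) :
    Tendsto (logTube D v) atBot (𝓝 0) := by
  refine squeeze_zero h.logTube_nonneg h.logTube_le ?_
  have : Tendsto (fun t => Real.exp ((1 - D) * t)) atBot (𝓝 0) :=
    Real.tendsto_exp_atBot.comp (tendsto_id.const_mul_atBot (sub_pos.2 h.dim_lt_one))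
  simpa using this.mul_const L

end IsTubeFunction

/-! ### Corners of the gap sums: the obstruction to a limit in the lattice case -/

theorem sum_add_sum_le_of_forall {ι : Type*} {s : Finset ι} {a b c : ι → ℝ} {e : ℝ} {i₀ : ι}
    (hi₀ : i₀ ∈ s) (h : ∀ i ∈ s, a i + b i ≤ 2 * c i) (h₀ : a i₀ + b i₀ ≤ 2 * c i₀ - e) :
    ∑ i ∈ s, a i + ∑ i ∈ s, b i ≤ 2 * ∑ i ∈ s, c i - e := by
  have := Finset.single_le_sum (f := fun i => 2 * c i - a i - b i)
    (fun i hi => by linarith [h i hi]) hi₀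
  simp only [Finset.sum_sub_distrib, ← Finset.mul_sum] at this
  linarith

/-- The sums of the gap contributions over the cosets of a lattice do not all agree: the gaps
produce kinks. -/
theorem not_forall_tendsto_sum_logGaps {Q : ℕ} {D d K : ℝ} {l : Fin Q → ℝ} (q₀ : Fin Q)
    (hl : ∀ q, 0 < l q) :
    ¬ ∀ t : ℝ, Tendsto
      (fun n : ℕ => ∑ i ∈ Finset.range (2 * n + 1), logGaps D l (t - n * d + i * d)) atTop
      (𝓝 K) := by
  intro hlim
  set g : ℝ → ℝ := fun ε => ∑ q, min (2 * ε) (l q) with hg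
  -- Written in ε and multiplied by `ε ^ (1 - D)`, the coset sums become positive combinations of
  -- dilates of the concave function `g`.
  set S : ℕ → ℝ → ℝ := fun n ε => ∑ i ∈ Finset.range (2 * n + 1),
    Real.exp ((1 - D) * (i * d - n * d)) * g (ε * Real.exp (-(i * d - n * d))) with hS
  have hSlim : ∀ ε > 0, Tendsto (fun n => S n ε) atTop (𝓝 (K * ε ^ (1 - D))) := by
    intro ε hε
    refine ((hlim (-Real.log ε)).mul_const (ε ^ (1 - D))).congr fun n => ?_
    rw [Finset.sum_mul]
    refine Finset.sum_congr rfl fun i _ => ?_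
    have e1 : Real.exp (-(-Real.log ε - n * d + i * d)) = ε * Real.exp (-(i * d - n * d)) := by
      rw [show -(-Real.log ε - n * d + i * d) = Real.log ε + -(i * d - n * d) by ring,
        Real.exp_add, Real.exp_log hε]
    have e2 : Real.exp ((1 - D) * (-Real.log ε - n * d + i * d)) * ε ^ (1 - D) =
        Real.exp ((1 - D) * (i * d - n * d)) := by
      rw [Real.rpow_def_of_pos hε, ← Real.exp_add]
      congr 1; ring
    rw [logGaps, e1, mul_right_comm, e2]
  have hmin : ∀ c a e : ℝ, min (2 * (a + e)) c + min (2 * (a - e)) c ≤ 2 * min (2 * a) c := by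
    intro c a e
    rcases min_choice (2 * a) c with h | h <;> rw [h]
    · linarith [min_le_left (2 * (a + e)) c, min_le_left (2 * (a - e)) c]
    · linarith [min_le_right (2 * (a + e)) c, min_le_right (2 * (a - e)) c]
  have hgc : ∀ a e, g (a + e) + g (a - e) ≤ 2 * g a := by
    intro a e
    simp only [hg]
    rw [← Finset.sum_add_distrib, Finset.mul_sum]
    exact Finset.sum_le_sum fun q _ => hmin (l q) a e
  -- The summand of `q₀` has a corner here: its slope drops from 2 to 0.
  set ε₀ := l q₀ / 2 with hε₀
  have hε₀pos : 0 < ε₀ := half_pos (hl q₀)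
  have hgk : ∀ δ > 0, g (ε₀ + δ) + g (ε₀ - δ) ≤ 2 * g ε₀ - 2 * δ := by
    intro δ hδ
    refine sum_add_sum_le_of_forall (Finset.mem_univ q₀) (fun q _ => hmin (l q) ε₀ δ) ?_
    have h2 : min (2 * (ε₀ + δ)) (l q₀) = l q₀ := min_eq_right (by linarith)
    have h3 : min (2 * (ε₀ - δ)) (l q₀) = 2 * (ε₀ - δ) := min_eq_left (by linarith)
    have h4 : min (2 * ε₀) (l q₀) = l q₀ := min_eq_right (by linarith)
    rw [h2, h3, h4]
    linarith
  have hSk : ∀ n, ∀ δ > 0, S n (ε₀ + δ) + S n (ε₀ - δ) ≤ 2 * S n ε₀ - 2 * δ := by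
    intro n δ hδ
    -- The middle index `i = n` gives the undilated copy of `g`, which carries the corner; concavity
    -- of the other terms keeps them from compensating.
    have hn : n ∈ Finset.range (2 * n + 1) := Finset.mem_range.2 (by omega)
    refine sum_add_sum_le_of_forall hn (fun i _ => ?_) ?_
    · have := mul_le_mul_of_nonneg_left (hgc (ε₀ * Real.exp (-(i * d - n * d)))
        (δ * Real.exp (-(i * d - n * d)))) (Real.exp_pos ((1 - D) * (i * d - n * d))).le
      rwa [← add_mul, ← sub_mul ε₀ δ, mul_add, mul_left_comm _ (2 : ℝ)] at this
    · simpa only [sub_self, mul_zero, Real.exp_zero, neg_zero, mul_one, one_mul] using hgk δ hδ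
  set f : ℝ → ℝ := fun x => K * x ^ (1 - D) with hf
  have hfk : ∀ δ, 0 < δ → δ < ε₀ → f (ε₀ + δ) + f (ε₀ - δ) ≤ 2 * f ε₀ - 2 * δ := by
    intro δ hδ hδ'
    exact le_of_tendsto_of_tendsto'
      ((hSlim _ (by linarith)).add (hSlim _ (by linarith)))
      (((hSlim _ hε₀pos).const_mul 2).sub_const _) fun n => hSk n δ hδ
  obtain ⟨f', hf'⟩ : ∃ f', HasDerivAt f f' ε₀ :=
    ⟨_, (Real.hasDerivAt_rpow_const (Or.inl hε₀pos.ne')).const_mul K⟩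
  -- Differentiability makes the second difference o(δ), whereas `hfk` bounds it by `-2 * δ`.
  have hF : HasDerivAt (fun δ => f (ε₀ + δ) + f (ε₀ - δ)) 0 0 := by
    have h1 : HasDerivAt (fun δ => f (ε₀ + δ)) f' 0 :=
      HasDerivAt.comp_const_add ε₀ 0 (by simpa using hf')
    have h2 : HasDerivAt (fun δ => f (ε₀ - δ)) (-f') 0 :=
      HasDerivAt.comp_const_sub ε₀ 0 (by simpa using hf')
    simpa using h1.fun_add h2
  rw [hasDerivAt_iff_isLittleO] at hF
  have hev := hF.def one_pos
  obtain ⟨ρ, hρ, hball⟩ := Metric.eventually_nhds_iff_ball.1 hev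
  set δ := min (ρ / 2) (ε₀ / 2) with hδ
  have hδ0 : 0 < δ := by positivity
  have hδρ : δ < ρ := (min_le_left _ _).trans_lt (by linarith)
  have hδε : δ < ε₀ := (min_le_right _ _).trans_lt (by linarith)
  have h1 := hball δ (by simpa [abs_of_pos hδ0] using hδρ)
  have h2 := hfk δ hδ0 hδε
  simp only [add_zero, sub_zero, smul_zero, one_mul, Real.norm_eq_abs, abs_of_pos hδ0] at h1
  rw [abs_le] at h1
  linarith [h1.1]

/-! ### Minkowski dimension and content -/

theorem tendsto_neg_log_nhdsGT_zero : Tendsto (fun ε : ℝ => -Real.log ε) (𝓝[>] 0) atTop :=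
  tendsto_neg_atBot_atTop.comp Real.tendsto_log_nhdsGT_zero

theorem tendsto_exp_neg_nhdsGT_zero : Tendsto (fun t : ℝ => Real.exp (-t)) atTop (𝓝[>] 0) :=
  tendsto_nhdsWithin_iff.2 ⟨Real.tendsto_exp_neg_atTop_nhds_zero,
    .of_forall fun _ => Real.exp_pos _⟩

theorem tendsto_two_mul_rpow_nhdsGT_zero {D : ℝ} (hD : 0 < D) :
    Tendsto (fun ε : ℝ => 2 * ε ^ D) (𝓝[>] 0) (𝓝 0) := by
  have := (Real.continuousAt_rpow_const 0 D (Or.inr hD.le)).tendsto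
  rw [Real.zero_rpow hD.ne'] at this
  simpa using (this.mono_left nhdsWithin_le_nhds).const_mul 2

namespace IsTubeFunction

variable {J Q : ℕ} {r : Fin J → ℝ} {D : ℝ} {l : Fin Q → ℝ} {v : ℝ → ℝ} {L : ℝ} {F : Set ℝ}

theorem tubeVolume_mul_rpow (hV : ∀ ε > 0, tubeVolume F ε = v ε + 2 * ε) {ε : ℝ} (hε : 0 < ε) :
    tubeVolume F ε * ε ^ (D - 1) = logTube D v (-Real.log ε) + 2 * ε ^ D := by
  rw [hV ε hε, logTube, neg_neg, Real.exp_log hε, add_mul]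
  congr 1
  · rw [Real.rpow_def_of_pos hε, mul_comm]
    congr 2; ring
  · rw [Real.rpow_sub_one hε.ne']
    field_simp

/-- The two outer collars contribute only `2 * ε ^ D`, which tends to 0. -/
theorem hasMinkowskiContent_iff (h : IsTubeFunction r D l v L)
    (hV : ∀ ε > 0, tubeVolume F ε = v ε + 2 * ε) (M : ℝ) :
    HasMinkowskiContent F D M ↔ Tendsto (logTube D v) atTop (𝓝 M) := by
  have hrem := tendsto_two_mul_rpow_nhdsGT_zero h.dim_pos
  rw [HasMinkowskiContent, Module.finrank_self, Nat.cast_one]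
  have heq : ∀ᶠ ε : ℝ in 𝓝[>] 0,
      tubeVolume F ε * ε ^ (D - 1) = logTube D v (-Real.log ε) + 2 * ε ^ D :=
    eventually_nhdsWithin_of_forall fun ε hε => tubeVolume_mul_rpow hV hε
  rw [tendsto_congr' heq]
  constructor
  · intro hM
    have h1 := (hM.sub hrem).comp tendsto_exp_neg_nhdsGT_zero
    simpa [Function.comp_def] using h1
  · intro hM
    simpa using (hM.comp tendsto_neg_log_nhdsGT_zero).add hrem

/-- The normalized tube volume stays between positive constants for ε < 1, so log V_F(ε) = (1 - D)
log ε + O(1). -/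
theorem hasMinkowskiDimension (h : IsTubeFunction r D l v L)
    (hV : ∀ ε > 0, tubeVolume F ε = v ε + 2 * ε) : HasMinkowskiDimension F D := by
  obtain ⟨B, hB⟩ := h.exists_logTube_le
  obtain ⟨c, hc, hcu⟩ := h.exists_le_logTube
  rw [HasMinkowskiDimension, Module.finrank_self, Nat.cast_one]
  set w : ℝ → ℝ := fun ε => logTube D v (-Real.log ε) + 2 * ε ^ D with hw
  have hlim : Tendsto (fun ε => Real.log (w ε) / Real.log ε) (𝓝[>] 0) (𝓝 0) := by
    set C := max |Real.log c| |Real.log (B + 2)|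
    refine squeeze_zero_norm' (a := fun ε => C / -Real.log ε) ?_
      (tendsto_const_nhds.div_atTop tendsto_neg_log_nhdsGT_zero)
    filter_upwards [Ioo_mem_nhdsGT (zero_lt_one' ℝ)] with ε hε
    have hlog : Real.log ε < 0 := Real.log_neg hε.1 hε.2
    have h1 : c ≤ w ε :=
      (hcu _ (by linarith)).trans (le_add_of_nonneg_right
        (mul_nonneg zero_le_two (Real.rpow_nonneg hε.1.le D)))
    have h2 : w ε ≤ B + 2 := by
      have := Real.rpow_le_one hε.1.le hε.2.le h.dim_pos.le
      have := hB (-Real.log ε)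
      simp only [hw]
      linarith
    rw [Real.norm_eq_abs, abs_div, abs_of_neg hlog]
    refine div_le_div_of_nonneg_right ?_ (by linarith)
    have h3 := Real.log_le_log hc h1
    have h4 := Real.log_le_log (hc.trans_le h1) h2
    exact abs_le_max_abs_abs h3 h4
  have hfin : Tendsto (fun ε => D - Real.log (w ε) / Real.log ε) (𝓝[>] 0) (𝓝 D) := by
    simpa using hlim.const_sub D
  refine hfin.congr' ?_
  filter_upwards [Ioo_mem_nhdsGT (zero_lt_one' ℝ)] with ε hε
  have hlog : Real.log ε < 0 := Real.log_neg hε.1 hε.2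
  have hV0 : 0 < tubeVolume F ε := by
    rw [hV ε hε.1]
    linarith [h.nonneg ε, hε.1]
  have e : Real.log (w ε) = Real.log (tubeVolume F ε) + (D - 1) * Real.log ε := by
    rw [hw]
    simp only
    rw [← tubeVolume_mul_rpow hV hε.1, Real.log_mul hV0.ne' (Real.rpow_pos_of_pos hε.1 _).ne',
      Real.log_rpow hε.1]
  rw [e]
  field_simp [hlog.ne]
  ring

theorem integral_tubeVolume (hV : ∀ ε > 0, tubeVolume F ε = v ε + 2 * ε) {T : ℝ} (hT : 1 < T) :
    ∫ ε in (1 / T)..1, ε ^ (-(1 - D)) * tubeVolume F ε / ε =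
      ∫ t in (0 : ℝ)..Real.log T, (logTube D v t + 2 * Real.exp (-D * t)) := by
  have hT0 : 0 < T := zero_lt_one.trans hT
  have hlog : 0 ≤ Real.log T := Real.log_nonneg hT.le
  have h1T : 1 / T ≤ 1 := by rw [div_le_one hT0]; exact hT.le
  have himg : (fun t : ℝ => Real.exp (-t)) '' Set.Icc 0 (Real.log T) = Set.Icc (1 / T) 1 := by
    ext ε
    constructor
    · rintro ⟨t, ht, rfl⟩
      refine ⟨?_, Real.exp_le_one_iff.2 (by linarith [ht.1])⟩
      rw [one_div, ← Real.exp_log (inv_pos.2 hT0), Real.log_inv]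
      exact Real.exp_le_exp.2 (by linarith [ht.2])
    · intro hε
      have hε0 : 0 < ε := (by positivity : 0 < 1 / T).trans_le hε.1
      refine ⟨-Real.log ε, ⟨by linarith [Real.log_nonpos hε0.le hε.2], ?_⟩, ?_⟩
      · have := Real.log_le_log (by positivity) hε.1
        rw [one_div, Real.log_inv] at this
        linarith
      · simp [Real.exp_log hε0]
  rw [intervalIntegral.integral_of_le h1T, intervalIntegral.integral_of_le hlog,
    ← integral_Icc_eq_integral_Ioc, ← integral_Icc_eq_integral_Ioc, ← himg,
    integral_image_eq_integral_abs_deriv_smul (f' := fun t => -Real.exp (-t)) measurableSet_Icc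
      (fun t _ => ?_) (fun s _ t _ hst => by simpa using hst)]
  · refine setIntegral_congr_fun measurableSet_Icc fun t _ => ?_
    have he := Real.exp_pos (-t)
    have := tubeVolume_mul_rpow (D := D) hV he
    rw [Real.log_exp, neg_neg, ← Real.exp_mul (-t) D] at this
    simp only [abs_neg, abs_of_pos he, smul_eq_mul, neg_sub]
    rw [mul_div_cancel₀ _ he.ne', mul_comm, this, neg_mul, neg_mul, mul_comm D t]
  · simpa using ((hasDerivAt_neg t).exp).hasDerivWithinAt

theorem hasAverageMinkowskiContent (h : IsTubeFunction r D l v L)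
    (hV : ∀ ε > 0, tubeVolume F ε = v ε + 2 * ε) :
    HasAverageMinkowskiContent F D (gapContent r l D) := by
  have : Nonempty (Fin J) := ⟨⟨0, by have := h.two_le; omega⟩⟩
  obtain ⟨B, hB⟩ := h.exists_logTube_le
  have h1 := h.isRenewalSolution.tendsto_average (B := B) fun t => by
    rw [abs_of_nonneg (h.logTube_nonneg t)]; exact hB t
  rw [h.integral_logGaps_div] at h1
  have hint : ∀ a b : ℝ, IntervalIntegrable (fun t => 2 * Real.exp (-D * t)) volume a b :=
    fun a b => Continuous.intervalIntegrable (by fun_prop) a b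
  have hlim : Tendsto (fun t => 2 * Real.exp (-D * t)) atTop (𝓝 0) := by
    have : Tendsto (fun t => Real.exp (-(D * t))) atTop (𝓝 0) :=
      Real.tendsto_exp_neg_atTop_nhds_zero.comp (tendsto_id.const_mul_atTop h.dim_pos)
    simpa using this.const_mul 2
  have h2 := IsRenewalSolution.tendsto_average_of_tendsto hint hlim
  have h3 := (h1.add h2).comp Real.tendsto_log_atTop
  rw [add_zero] at h3
  rw [HasAverageMinkowskiContent, Module.finrank_self, Nat.cast_one]
  refine h3.congr' ?_
  filter_upwards [eventually_gt_atTop 1] with T hT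
  rw [integral_tubeVolume hV hT, intervalIntegral.integral_add
    (h.isRenewalSolution.intervalIntegrable _ _) (hint _ _)]
  simp only [Function.comp_apply]
  ring

theorem gapContent_pos (h : IsTubeFunction r D l v L) : 0 < gapContent r l D := by
  have h1D := sub_pos.2 h.dim_lt_one
  have hD := h.dim_pos
  have h1 : 0 < ∑ q, l q ^ D :=
    Finset.sum_pos (fun q _ => Real.rpow_pos_of_pos (h.gap_pos q) D)
      ⟨⟨0, h.gaps_pos⟩, Finset.mem_univ _⟩
  have h2 : 0 < ∑ j, r j ^ D * Real.log (r j)⁻¹ :=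
    Finset.sum_pos (fun j _ => mul_pos (Real.rpow_pos_of_pos (h.ratio_pos j) D) (h.step_pos j))
      ⟨⟨0, by have := h.two_le; omega⟩, Finset.mem_univ _⟩
  rw [gapContent]
  positivity

theorem closure_range_log_inv (r : Fin J → ℝ) :
    AddSubgroup.closure (Set.range fun j => Real.log (r j)⁻¹) =
      AddSubgroup.closure (Set.range fun j => Real.log (r j)) := by
  rw [← AddSubgroup.closure_neg]
  congr 1
  ext x
  simp [Real.log_inv, Set.mem_range]

theorem hasMinkowskiContent_of_not_isLatticeType (h : IsTubeFunction r D l v L)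
    (hV : ∀ ε > 0, tubeVolume F ε = v ε + 2 * ε) (hr : ¬ IsLatticeType r) :
    HasMinkowskiContent F D (gapContent r l D) := by
  have : Nonempty (Fin J) := ⟨⟨0, by have := h.two_le; omega⟩⟩
  have hdense : Dense (AddSubgroup.closure
      (Set.range fun j => Real.log (r j)⁻¹) : Set ℝ) := by
    rw [closure_range_log_inv]
    -- A subgroup of the line is dense or cyclic, and a cyclic one is discrete.
    refine (AddSubgroup.dense_or_cyclic _).resolve_right ?_
    rintro ⟨a, ha⟩
    refine hr ?_
    rw [IsLatticeType, ha, ← AddSubgroup.zmultiples_eq_closure]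
    infer_instance
  obtain ⟨B, hB⟩ := h.exists_logTube_le
  rw [h.hasMinkowskiContent_iff hV, ← h.integral_logGaps_div]
  exact h.isRenewalSolution.tendsto_atTop hdense h.logTube_nonneg
    (fun t => by rw [abs_of_nonneg (h.logTube_nonneg t)]; exact hB t)
    (sub_pos.2 h.dim_lt_one).le h.logTube_add_le

theorem exists_nat_mul_of_isLatticeType (h : IsTubeFunction r D l v L) (hr : IsLatticeType r) :
    ∃ (d : ℝ) (k : Fin J → ℕ), 0 < d ∧ ∀ j, Real.log (r j)⁻¹ = k j * d := by
  rw [IsLatticeType, ← AddSubgroup.discrete_iff_addCyclic, ← closure_range_log_inv] at hr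
  obtain ⟨a, ha⟩ := (AddSubgroup.isAddCyclic_iff_exists_zmultiples_eq_top _).1 hr
  have hmem : ∀ j, ∃ n : ℤ, n * a = Real.log (r j)⁻¹ := fun j => by
    have hj : Real.log (r j)⁻¹ ∈ AddSubgroup.closure (Set.range fun j => Real.log (r j)⁻¹) :=
      AddSubgroup.subset_closure ⟨j, rfl⟩
    rw [← ha] at hj
    obtain ⟨n, hn⟩ := AddSubgroup.mem_zmultiples_iff.1 hj
    exact ⟨n, by simpa using hn⟩
  choose n hn using hmem
  have ha0 : 0 < |a| := by
    rw [abs_pos]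
    rintro rfl
    have := h.step_pos ⟨0, by have := h.two_le; omega⟩
    rw [← hn] at this
    simp at this
  refine ⟨|a|, fun j => (n j).natAbs, ha0, fun j => ?_⟩
  rw [← abs_of_pos (h.step_pos j), ← hn j, abs_mul]
  simp

/-- Every real `M` is excluded, including 0, so the content itself fails to exist. -/
theorem not_hasMinkowskiContent_of_isLatticeType (h : IsTubeFunction r D l v L)
    (hV : ∀ ε > 0, tubeVolume F ε = v ε + 2 * ε) (hr : IsLatticeType r) (M : ℝ) :
    ¬ HasMinkowskiContent F D M := by
  rw [h.hasMinkowskiContent_iff hV]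
  intro hM
  obtain ⟨d, k, hd, hk⟩ := h.exists_nat_mul_of_isLatticeType hr
  exact not_forall_tendsto_sum_logGaps ⟨0, h.gaps_pos⟩ h.gap_pos fun t =>
    h.isRenewalSolution.tendsto_sum_of_tendsto hd hk hM h.tendsto_logTube_atBot t

end IsTubeFunction

/-! ### Bounds on the dimension and the main theorem -/

theorem dim_pos_of_sum_rpow_eq_one {J : ℕ} (hJ : 2 ≤ J) {r : Fin J → ℝ} (hr : ∀ j, 0 < r j)
    (hr1 : ∀ j, r j < 1) {D : ℝ} (hD : ∑ j, r j ^ D = 1) : 0 < D := by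
  by_contra! h
  have h1 : ∑ _j : Fin J, (1 : ℝ) ≤ ∑ j, r j ^ D := Finset.sum_le_sum fun j _ =>
    Real.one_le_rpow_of_pos_of_le_one_of_nonpos (hr j) (hr1 j).le h
  rw [hD] at h1
  simp at h1
  omega

/-- The strict inequality `∑ j, r j < 1` reflects the presence of gaps; for `D ≥ 1` the sum of the
`r j ^ D` could only be smaller. -/
theorem dim_lt_one_of_sum_rpow_eq_one {J : ℕ} {r : Fin J → ℝ} (hr : ∀ j, 0 < r j)
    (hr1 : ∀ j, r j < 1) (hsum : ∑ j, r j < 1) {D : ℝ} (hD : ∑ j, r j ^ D = 1) : D < 1 := by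
  by_contra! h
  have h1 : ∑ j, r j ^ D ≤ ∑ j, r j := Finset.sum_le_sum fun j _ => by
    simpa using Real.rpow_le_rpow_of_exponent_ge (hr j) (hr1 j).le h
  linarith

end

theorem mainTheorem2 {J : ℕ} (hJ : 2 ≤ J) (φ : Fin J → ℝ → ℝ) (r : Fin J → ℝ)
    (hφ : IsSimilitudeSystem φ r) (F : Set ℝ) (hF : IsSelfSimilarSet φ F)
    (hTSC : TilesetCondition φ F) (hNTC : NontrivialityCondition φ F)
    (D : ℝ) (hD : ∑ j, r j ^ D = 1) :
    0 < D ∧ D < 1 ∧ HasMinkowskiDimension F D ∧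
    IsScalingZetaExtension r D (scalingZeta r) ∧
    ∃ (Q : ℕ) (G : Fin Q → Set ℝ) (l : Fin Q → ℝ) (κ : Fin Q → ℕ → ℝ),
      0 < Q ∧ Q ≤ J - 1 ∧
      -- `G` enumerates the generators without repetition
      Function.Injective G ∧ Set.range G = generators φ F ∧
      -- each generator is an open interval, and its tube data
      (∀ q, 0 < l q ∧ (∃ a : ℝ, G q = Set.Ioo a (a + l q)) ∧
        (∀ ε : ℝ, 0 ≤ ε → ε < inradius (G q) → innerTubeVolume (G q) ε = 2 * ε) ∧
        (∀ ε : ℝ, inradius (G q) ≤ ε → innerTubeVolume (G q) ε = l q) ∧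
        IsSteinerLike (G q) (κ q) ∧
        κ q 0 = 2 ∧ κ q 1 = -l q ∧ inradius (G q) = l q / 2) ∧
      -- the geometric zeta functions
      (∀ (q : Fin Q) (s : ℂ) (ε : ℝ), s ≠ 0 → s ≠ 1 → 0 < ε →
        geometricZeta r (G q) (κ q) s ε =
          scalingZeta r s * (ε : ℂ) ^ (1 - s) *
            (2 * (inradius (G q) : ℂ) ^ s / s
              - (l q : ℂ) * (inradius (G q) : ℂ) ^ (s - 1) / (s - 1)) ∧
        geometricZeta r (G q) (κ q) s ε =
          scalingZeta r s * (ε : ℂ) ^ (1 - s) *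
            (2 ^ (1 - s) * (l q : ℂ) ^ s / (s * (1 - s)))) ∧
      -- the residues at `D`
      (∀ ε : ℝ, 0 < ε →
        HasResidueAt (fun s => (∑ q, geometricZeta r (G q) (κ q) s ε) * (ε : ℂ) ^ (s - 1))
          (D : ℂ) (gapContent r l D : ℂ)) ∧
      HasResidueAt
        (fun s => scalingZeta r s * (2 ^ (1 - s) / (s * (1 - s))) * ∑ q, (l q : ℂ) ^ s)
        (D : ℂ) (gapContent r l D : ℂ) ∧
      -- non-lattice case
      (¬ IsLatticeType r →
        IsMinkowskiMeasurable F D ∧ HasMinkowskiContent F D (gapContent r l D)) ∧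
      -- lattice case
      (IsLatticeType r →
        ¬ IsMinkowskiMeasurable F D ∧ HasAverageMinkowskiContent F D (gapContent r l D)) := by
  obtain ⟨Q, x, y, v, L, hQ0, hQJ, hxy, hinj, hrange, hsum, hV, hmono, hnonneg, hle, heq⟩ :=
    exists_generators_and_tube hφ hF hTSC hNTC
  have hr := hφ.ratio_pos
  have hr1 := hφ.ratio_lt_one
  have hD0 := dim_pos_of_sum_rpow_eq_one hJ hr hr1 hD
  have hD1 := dim_lt_one_of_sum_rpow_eq_one hr hr1 hsum hD
  have hl : ∀ q, 0 < y q - x q := fun q => sub_pos.2 (hxy q)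
  have h : IsTubeFunction r D (fun q => y q - x q) v L :=
    ⟨hJ, hQ0, hr, hr1, hD0, hD1, hD, hl, hmono, hnonneg, hle, heq⟩
  refine ⟨hD0, hD1, h.hasMinkowskiDimension hV, isScalingZetaExtension_scalingZeta hr hr1 hD,
    Q, fun q => Set.Ioo (x q) (y q), fun q => y q - x q,
    fun q m => if m = 0 then 2 else -(y q - x q), hQ0, hQJ, hinj, hrange, fun q => ?_,
    fun q s ε hs0 hs1 _ => geometricZeta_Ioo r (hxy q) ε hs0 hs1,
    fun ε hε => hasResidueAt_sum_geometricZeta hr hr1 hD0 hD1 hD hxy hε,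
    hasResidueAt_gapContent hr hr1 hD0 hD1 hD hl, fun hlat => ?_, fun hlat => ?_⟩
  · have hin := inradius_Ioo (hxy q)
    refine ⟨hl q, ⟨x q, by simp⟩, fun ε h0 hε => ?_, fun ε hε => ?_, isSteinerLike_Ioo (hxy q),
      by simp, by simp, hin⟩
    · rw [hin] at hε
      rw [innerTubeVolume_Ioo (hxy q) h0, min_eq_left (by linarith)]
    · rw [hin] at hε
      rw [innerTubeVolume_Ioo (hxy q) (by linarith [hl q]), min_eq_right (by linarith)]
  · have hM := h.hasMinkowskiContent_of_not_isLatticeType hV hlat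
    exact ⟨⟨_, h.gapContent_pos.ne', hM⟩, hM⟩
  · exact ⟨fun ⟨M, _, hM⟩ => h.not_hasMinkowskiContent_of_isLatticeType hV hlat M hM,
      h.hasAverageMinkowskiContent hV⟩
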